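/- All fields have characteristic zero. For a difference field $(F,\sigma)$ ($\sigma$ an automorphism of $F$) let $C_F=\{c\in F:\sigma(c)=c\}$ and $\Delta(f)=\sigma(f)-f$. A $C$-linear map $\phi:V\to V$ is a complete reduction for a $C$-subspace $U\subseteq V$ if $f-\phi(f)\in U$ for all $f\in V$ and $\ker\phi=U$. Let $(F_n,\sigma)$ be a $\Sigma^*$-tower over $(F_0,\sigma)$: $F_0\le F_1\le\dots\le F_n$ with $F_i=F_{i-1}(t_i)$, $t_i$ transcendental over $F_{i-1}$, $\sigma(t_i)-t_i\in F_{i-1}$ for $1\le i\le n$, $\sigma$ an automorphism of $F_n$ that restricts to an automorphism of $F_0$, and $C:=C_{F_n}=C_{F_0}$. For $f\in F_n$ let $\operatorname{ind}_n(f)=\min\{0\le i\le n: f\in F_i\}$. For $1\le i\le n$ let $M_i$ be the set of monic irreducible polynomials of positive degree in $F_{i-1}[t_i]$, let $\Theta_i=\{t_i^k: k\ge 0\}\cup\{t_i^k/q^j: q\in M_i,\ 0\le k<\deg_{t_i} q,\ j\ge1\}$ (the canonical $F_{i-1}$-basis of $F_i$), and let $S_i\subseteq M_i$ be any set of representatives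 of the classes of $M_i$ under the relation: $p\sim q$ iff $p=c\,\sigma^{\ell}(q)$ for some $c\in F_{i-1}^\times$, $\ell\in\mathbb Z$. Let $U_{S_i}$ be the set of fractions $a/(p_1^{m_1}\cdots p_l^{m_l})$ with $a\in F_{i-1}[t_i]$, $p_1,\dots,p_l\in S_i$, $m_1,\dots,m_l\ge 0$, whose numerator has smaller degree in $t_i$ than the denominator. Let $\phi_0:F_0\to F_0$ be a complete reduction for $\Delta(F_0)$, let $\Theta_0$ be a $C$-basis of $F_0$, and let $\Xi=\{\theta_0\theta_1\cdots\theta_n:\theta_i\in\Theta_i\}$. Theorem. $\Xi$ is a $C$-basis of $F_n$; for $\theta\in\Xi$ let $\theta^*:F_n\to C$ denote the corresponding coordinate functional. Moreover, starting from the given $\phi_0$, for each $0\le i\le n$ there is a complete reduction $\phi_i:F_i\to F_i$ for $\Delta(F_i)$, and for each $1\le i\le n$ a second pair $(\theta_i,c_i)\in\Xi\times C$ associated to $F_{i-1}(t_i)$, that is, $$\theta_i\in F_{i-1},\qquad c_i=\theta_i^*\big(\phi_{i-1}(\Delta(t_i))\big)\neq 0,$$ such that $$\operatorname{ind}_n(\theta_i)=\operatorname{ind}_n\big(\phi_{i-1}(\Delta(t_i))\big),$$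 and such that $\phi_i$ is the complete reduction determined by $\phi_{i-1}$, $S_i$ and $\theta_i$: with $V_{\theta_i}=\bigoplus_{k\ge0}\big(\operatorname{im}(\phi_{i-1})\cap\ker(\theta_i^*)\big)t_i^k$ one has $$F_i=\Delta(F_i)\oplus U_{S_i}\oplus V_{\theta_i},\qquad \operatorname{im}(\phi_i)=U_{S_i}\oplus V_{\theta_i}.$$ -/

import Mathlib

open Polynomial

namespace SigmaReduction

/-- A `C`-linear operator `φ` on `V` is a complete reduction for the subspace `U` if
`f - φ f ∈ U` for all `f`, and the kernel of `φ` is `U`. -/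
def IsCompleteReduction {C V : Type*} [Field C] [AddCommGroup V] [Module C V]
    (U : Submodule C V) (φ : V →ₗ[C] V) : Prop :=
  (∀ f : V, f - φ f ∈ U) ∧ LinearMap.ker φ = U

/-- The field of constants of the difference field `(E, σ)`. -/
def constField {E : Type*} [Field E] (σ : E ≃+* E) : Subfield E where
  carrier := {c | σ c = c}
  mul_mem' := by
    intro a b ha hb
    simp only [Set.mem_ofPred_eq] at ha hb ⊢
    rw [map_mul, ha, hb]
  one_mem' := map_one σ
  add_mem' := by
    intro a b ha hb
    simp only [Set.mem_ofPred_eq] at ha hb ⊢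
    rw [map_add, ha, hb]
  zero_mem' := map_zero σ
  neg_mem' := by
    intro a ha
    simp only [Set.mem_ofPred_eq] at ha ⊢
    rw [map_neg, ha]
  inv_mem' := by
    intro a ha
    simp only [Set.mem_ofPred_eq] at ha ⊢
    rw [map_inv₀, ha]

section OneStep

variable {k E : Type*} [Field k] [Field E] [Algebra k E]

/-- The set `M_t` of monic irreducible polynomials in `K[t]`, as elements of the field `E ∋ t`. -/
def monicIrreducibles (K : IntermediateField k E) (t : E) : Set E :=
  {p | ∃ q : K[X], q.Monic ∧ Irreducible q ∧ p = aeval t q}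

/-- The canonical `K`-basis of `K(t)`: the powers `t ^ i`, and the fractions `t ^ i / q ^ j` with
`q` monic irreducible, `i < deg q` and `j ≥ 1`. -/
def stepBasis (K : IntermediateField k E) (t : E) : Set E :=
  {θ | ∃ i : ℕ, θ = t ^ i} ∪
  {θ | ∃ (q : K[X]) (i j : ℕ), q.Monic ∧ Irreducible q ∧ i < q.natDegree ∧ 1 ≤ j ∧
    θ = t ^ i / (aeval t q) ^ j}

/-- `f` is `t`-proper: a fraction of polynomials in `K[t]` whose numerator has smaller degree than
its denominator (`0` is `t`-proper, since the zero polynomial has degree `⊥`). -/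
def IsProper (K : IntermediateField k E) (t f : E) : Prop :=
  ∃ a d : K[X], a.degree < d.degree ∧ f = aeval t a / aeval t d

/-- `σ`-equivalence over `K`: `p = c * σ ^ ℓ (q)` for some nonzero `c` in `K` and integer `ℓ`. -/
def SigmaEquiv (σ : E ≃+* E) (K : IntermediateField k E) (p q : E) : Prop :=
  ∃ c ∈ K, c ≠ 0 ∧ ∃ l : ℤ, p = c * (σ ^ l) q

/-- `S` is a set of representatives of the `σ`-equivalence classes on `M_t`. -/
def IsRepresentativeSet (σ : E ≃+* E) (K : IntermediateField k E) (t : E) (S : Set E) : Prop :=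
  S ⊆ monicIrreducibles K t ∧
    ∀ q ∈ monicIrreducibles K t, ∃! p : E, p ∈ S ∧ SigmaEquiv σ K p q

/-- The set `U_S` of `t`-proper fractions `a / (p₁ ^ m₁ ⋯ p_l ^ m_l)` with `a ∈ K[t]` and all
`p_i ∈ S`. -/
def properComplement (K : IntermediateField k E) (t : E) (S : Set E) : Set E :=
  {f | IsProper K t f ∧ ∃ a : K[X], ∃ d ∈ Submonoid.closure S, f = aeval t a / d}

/-- The set `V_θ` of polynomials in `K[t]` all of whose coefficients lie in the image of `φ` and in
the kernel of the functional `ev = θ^*`. -/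
def polyComplement (K : IntermediateField k E) (t : E) (φ : K →ₗ[k] K) (ev : E →ₗ[k] k) :
    Set E :=
  {f | ∃ p : K[X], (∀ i : ℕ, p.coeff i ∈ LinearMap.range φ ∧ ev (p.coeff i : E) = 0) ∧
    f = aeval t p}

end OneStep

/-- A tower `F 0 ≤ F 1 ≤ ⋯ ≤ F n = E` of `Σ^*`-extensions, with `F (i+1) = F i (t i)`
for `i = 0, …, n-1`. The levels are intermediate fields over the constant field of `(E, σ)`; so
`F 0` contains all constants of `E`, that is, `E` and `F 0` have the same constants. -/
structure SigmaTower {E : Type*} [Field E] (σ : E ≃+* E) (n : ℕ) where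
  F : Fin (n + 1) → IntermediateField (constField σ) E
  t : Fin n → E
  base_stable : ∀ x : E, σ x ∈ F 0 ↔ x ∈ F 0
  transcendental : ∀ i : Fin n, Transcendental (F i.castSucc) (t i)
  adjoin_eq : ∀ i : Fin n,
    F i.succ = IntermediateField.adjoin (constField σ) (insert (t i) (F i.castSucc : Set E))
  delta_mem : ∀ i : Fin n, σ (t i) - t i ∈ F i.castSucc
  top_eq : F (Fin.last n) = ⊤

namespace SigmaTower

variable {E : Type*} [Field E] {σ : E ≃+* E} {n : ℕ} (T : SigmaTower σ n)

/-- The summable space `Δ(F i) = {σ g - g | g ∈ F i}`, as a subspace of `F i` over the constants. -/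
def summable (i : Fin (n + 1)) : Submodule (constField σ) (T.F i) where
  carrier := {f | ∃ g : T.F i, (f : E) = σ (g : E) - (g : E)}
  zero_mem' := ⟨0, by simp⟩
  add_mem' := by
    rintro a b ⟨g, hg⟩ ⟨h, hh⟩
    refine ⟨g + h, ?_⟩
    push_cast
    rw [hg, hh, map_add]
    ring
  smul_mem' := by
    rintro c a ⟨g, hg⟩
    refine ⟨c • g, ?_⟩
    have hc : σ (c : E) = (c : E) := c.2
    simp only [IntermediateField.coe_smul, Subfield.smul_def, smul_eq_mul]
    rw [hg, map_mul, hc]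
    ring

/-- `Δ(t i) = σ (t i) - t i`, as an element of `F i`. -/
def deltaGen (i : Fin n) : T.F i.castSucc := ⟨σ (T.t i) - T.t i, T.delta_mem i⟩

/-- The indicator of `f ∈ F n`: the smallest `i ≤ n` with `f ∈ F i`. -/
noncomputable def ind (f : E) : ℕ := sInf {m : ℕ | ∃ i : Fin (n + 1), (i : ℕ) = m ∧ f ∈ T.F i}

/-- The `Θ₀`-canonical basis `Ξ` of `F n`: all products of an element of `Θ₀` and one element of
each of the canonical bases of `F (i+1) = F i (t i)` over `F i`. -/
def canonicalBasis (Θ₀ : Set (T.F 0)) : Set E :=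
  {ξ | ∃ θ₀ ∈ Θ₀, ∃ θ : Fin n → E, (∀ i, θ i ∈ stepBasis (T.F i.castSucc) (T.t i)) ∧
    ξ = (θ₀ : E) * ∏ i, θ i}

/-- `(θ, c)` is a second pair associated to `F (i+1) = F i (t i)` with respect to `φ` on `F i`:
`θ` is an element of the canonical basis that lies in `F i` (these elements form the canonical
basis of `F i`), and `c = θ^*(φ(Δ(t i)))` is nonzero, that is, `θ` is effective for `φ(Δ(t i))`.
Here `θ^*` is the coordinate functional of the basis `B`. -/
def IsSecondPair {Θ₀ : Set (T.F 0)}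
    (B : Module.Basis (T.canonicalBasis Θ₀) (constField σ) E) (i : Fin n)
    (φ : T.F i.castSucc →ₗ[constField σ] T.F i.castSucc)
    (θ : T.canonicalBasis Θ₀) (c : constField σ) : Prop :=
  (θ : E) ∈ T.F i.castSucc ∧ c = B.coord θ (φ (T.deltaGen i) : E) ∧ c ≠ 0

/-- `ψ` is the operator on `F (i+1) = F i (t i)` that establishes the direct sum
`F (i+1) = Δ(F (i+1)) ⊕ U_S ⊕ V_θ`: every element has exactly one such decomposition, and
`U_S ⊕ V_θ` is the image of `ψ`. The argument `ev` is the functional `θ^*`. -/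
def EstablishesDecomposition (i : Fin n) (S : Set E)
    (φ : T.F i.castSucc →ₗ[constField σ] T.F i.castSucc) (ev : E →ₗ[constField σ] constField σ)
    (ψ : T.F i.succ →ₗ[constField σ] T.F i.succ) : Prop :=
  (∀ f ∈ T.F i.succ, ∃! x : E × E × E,
    (∃ g ∈ T.F i.succ, x.1 = σ g - g) ∧
    x.2.1 ∈ properComplement (T.F i.castSucc) (T.t i) S ∧
    x.2.2 ∈ polyComplement (T.F i.castSucc) (T.t i) φ ev ∧
    f = x.1 + x.2.1 + x.2.2) ∧
  ∀ h : T.F i.succ, h ∈ LinearMap.range ψ ↔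
    ∃ u ∈ properComplement (T.F i.castSucc) (T.t i) S,
      ∃ v ∈ polyComplement (T.F i.castSucc) (T.t i) φ ev, (h : E) = u + v

end SigmaTower

end SigmaReduction

/-! The heart is one extension L = K(t) whose base K carries a complete reduction φ. No t - g with g
in K is a constant, so φ(Δ(t)) ≠ 0 (`apply_deltaGen_ne_zero`). Among the basis elements effective
for it, one of largest indicator has the indicator of φ(Δ(t)) itself
(`exists_coord_ne_zero_ind_eq`); call it θ. Then W = im φ ∩ ker θ^* is a complement of Δ(K) ⊕ C Δ(t)
in K.

Elements of L split into a polynomial and a proper part, and σ respects both. Moving a partial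
fraction along the σ-orbit of its denominator to the representative in S costs only a difference,
which leaves U_S. Directness on this side rests on orbits being infinite: a period would put t in K
by a trace argument (`eq_zero_of_zpow_fixed`). Hence the two extreme poles of g on an orbit survive
at two distinct points of Δ(g), while U_S allows a single pole per orbit
(`eq_zero_of_delta_mem_properComplement`).

On the polynomial side, for constant c the polynomial Δ(b t^i + c t^(i+1)/(i+1)) has degree at most
i and t^i-coefficient Δ(b) + c Δ(t). Induction on the degree therefore pushes all coefficients into
W (`monomial_mem_of_delta_mem`), and the two highest coefficients of a difference give directness
(`delta_eq_zero_of_coeff_mem`).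

The projection onto U_S ⊕ V_θ along Δ(L) is the next reduction (`exists_next_reduction`), and
recursion climbs the tower. The basis Ξ comes from partial fractions at each step and
multiplicativity of bases (`partialBasis_spec`). -/

namespace SigmaReduction

/-! ### Rational functions: poles, proper parts and partial fractions. -/

section Fractions

variable {k E : Type*} [Field k] [Field E] [Algebra k E] {K : IntermediateField k E} {t : E}

theorem aeval_ne_zero_of_transcendental (ht : Transcendental K t) {d : K[X]} (hd : d ≠ 0) :
    aeval t d ≠ 0 := fun h => hd (transcendental_iff.1 ht d h)

theorem aeval_injective_of_transcendental (ht : Transcendental K t) :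
    Function.Injective (aeval t : K[X] →ₐ[K] E) := transcendental_iff_injective.1 ht

/-- The elements of `K(t)`, as quotients of polynomials. -/
def IsFraction (K : IntermediateField k E) (t f : E) : Prop :=
  ∃ a d : K[X], d ≠ 0 ∧ f = aeval t a / aeval t d

/-- `f` is a fraction whose denominator is not divisible by `q`. -/
def RegularAt (K : IntermediateField k E) (t : E) (q : K[X]) (f : E) : Prop :=
  ∃ a d : K[X], ¬ q ∣ d ∧ f = aeval t a / aeval t d

theorem ne_zero_of_not_dvd {q d : K[X]} (h : ¬ q ∣ d) : d ≠ 0 := by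
  rintro rfl
  exact h (dvd_zero q)

theorem RegularAt.add (ht : Transcendental K t) {q : K[X]} (hq : Irreducible q) {f g : E}
    (hf : RegularAt K t q f) (hg : RegularAt K t q g) : RegularAt K t q (f + g) := by
  obtain ⟨a, d, hd, rfl⟩ := hf
  obtain ⟨b, e, he, rfl⟩ := hg
  refine ⟨a * e + d * b, d * e, fun h => (hq.prime.dvd_or_dvd h).elim hd he, ?_⟩
  have hd' := aeval_ne_zero_of_transcendental ht (ne_zero_of_not_dvd hd)
  have he' := aeval_ne_zero_of_transcendental ht (ne_zero_of_not_dvd he)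
  simp only [map_add, map_mul]
  rw [div_add_div _ _ hd' he']

theorem RegularAt.mul {q : K[X]} (hq : Irreducible q) {f g : E}
    (hf : RegularAt K t q f) (hg : RegularAt K t q g) : RegularAt K t q (f * g) := by
  obtain ⟨a, d, hd, rfl⟩ := hf
  obtain ⟨b, e, he, rfl⟩ := hg
  refine ⟨a * b, d * e, fun h => (hq.prime.dvd_or_dvd h).elim hd he, ?_⟩
  simp only [map_mul]
  rw [div_mul_div_comm]

theorem regularAt_aeval {q : K[X]} (hq : Irreducible q) (p : K[X]) :
    RegularAt K t q (aeval t p) :=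
  ⟨p, 1, fun h => hq.not_isUnit (isUnit_of_dvd_one h), by simp⟩

theorem RegularAt.neg {q : K[X]} {f : E} (hf : RegularAt K t q f) : RegularAt K t q (-f) := by
  obtain ⟨a, d, hd, rfl⟩ := hf
  exact ⟨-a, d, hd, by rw [map_neg, neg_div]⟩

theorem RegularAt.sub (ht : Transcendental K t) {q : K[X]} (hq : Irreducible q) {f g : E}
    (hf : RegularAt K t q f) (hg : RegularAt K t q g) : RegularAt K t q (f - g) := by
  rw [sub_eq_add_neg]
  exact hf.add ht hq hg.neg

theorem RegularAt.sum (ht : Transcendental K t) {q : K[X]} (hq : Irreducible q) {ι : Type*}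
    {f : ι → E} {s : Finset ι} (hf : ∀ i ∈ s, RegularAt K t q (f i)) :
    RegularAt K t q (∑ i ∈ s, f i) := by
  classical
  induction s using Finset.induction_on with
  | empty => simpa using regularAt_aeval (t := t) hq 0
  | insert i s hi ih =>
    rw [Finset.sum_insert hi]
    exact (hf i (Finset.mem_insert_self i s)).add ht hq
      (ih fun j hj => hf j (Finset.mem_insert_of_mem hj))

/-- A quotient by `q` which is regular at `q` is a polynomial. -/
theorem dvd_of_regularAt_div (ht : Transcendental K t) {q : K[X]} (hq : Irreducible q)
    {r : K[X]} (h : RegularAt K t q (aeval t r / aeval t q)) : q ∣ r := by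
  obtain ⟨a, d, hd, h⟩ := h
  have hd' := aeval_ne_zero_of_transcendental ht (ne_zero_of_not_dvd hd)
  have hq' := aeval_ne_zero_of_transcendental ht hq.ne_zero
  rw [div_eq_div_iff hq' hd', ← map_mul, ← map_mul] at h
  have h' := aeval_injective_of_transcendental ht h
  exact (hq.prime.dvd_or_dvd (h' ▸ dvd_mul_left q a)).resolve_right hd

theorem IsFraction.exists_isCoprime (ht : Transcendental K t) {f : E} (hf : IsFraction K t f) :
    ∃ a d : K[X], d ≠ 0 ∧ IsCoprime a d ∧ f = aeval t a / aeval t d := by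
  classical
  obtain ⟨a, d, hd, rfl⟩ := hf
  have hg : EuclideanDomain.gcd a d ≠ 0 := fun h => hd (EuclideanDomain.gcd_eq_zero_iff.1 h).2
  obtain ⟨a', ha⟩ := EuclideanDomain.gcd_dvd_left a d
  obtain ⟨d', hd'⟩ := EuclideanDomain.gcd_dvd_right a d
  have h0 : d' ≠ 0 := by
    rintro rfl
    exact hd (by rw [hd', mul_zero])
  refine ⟨a', d', h0, ?_, ?_⟩
  · obtain ⟨x, y, hxy⟩ : ∃ x y, EuclideanDomain.gcd a d = a * x + d * y :=
      ⟨_, _, EuclideanDomain.gcd_eq_gcd_ab a d⟩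
    refine ⟨x, y, mul_left_cancel₀ hg ?_⟩
    calc EuclideanDomain.gcd a d * (x * a' + y * d')
        = EuclideanDomain.gcd a d * a' * x + EuclideanDomain.gcd a d * d' * y := by ring
      _ = EuclideanDomain.gcd a d * 1 := by rw [← ha, ← hd', ← hxy, mul_one]
  · generalize EuclideanDomain.gcd a d = g at hg ha hd'
    rw [ha, hd', map_mul, map_mul, mul_div_mul_left _ _ (aeval_ne_zero_of_transcendental ht hg)]

theorem exists_monic_irreducible_factor {d : K[X]} (hd : d ≠ 0) (hu : ¬ IsUnit d) :
    ∃ q : K[X], q.Monic ∧ Irreducible q ∧ q ∣ d := by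
  classical
  obtain ⟨q, hq, hqd⟩ := WfDvdMonoid.exists_irreducible_factor hu hd
  have ha : Associated q (normalize q) := (normalize_associated q).symm
  exact ⟨normalize q, monic_normalize hq.ne_zero, ha.irreducible hq, ha.dvd_iff_dvd_left.1 hqd⟩

/-- A fraction which is regular at all irreducible polynomials is a polynomial. -/
theorem IsFraction.exists_eq_aeval (ht : Transcendental K t) {f : E} (hf : IsFraction K t f)
    (h : ∀ q : K[X], q.Monic → Irreducible q → RegularAt K t q f) :
    ∃ p : K[X], f = aeval t p := by
  obtain ⟨a, d, hd, hc, rfl⟩ := hf.exists_isCoprime ht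
  by_cases hu : IsUnit d
  · obtain ⟨e, he⟩ := hu.exists_right_inv
    refine ⟨a * e, ?_⟩
    rw [div_eq_iff (aeval_ne_zero_of_transcendental ht hd), ← map_mul]
    congr 1
    calc a = a * (d * e) := by rw [he, mul_one]
      _ = a * e * d := by ring
  · obtain ⟨q, hm, hq, hqd⟩ := exists_monic_irreducible_factor hd hu
    exfalso
    obtain ⟨b, e, he, hbe⟩ := h q hm hq
    rw [div_eq_div_iff (aeval_ne_zero_of_transcendental ht hd)
      (aeval_ne_zero_of_transcendental ht (ne_zero_of_not_dvd he)), ← map_mul, ← map_mul] at hbe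
    have h' := aeval_injective_of_transcendental ht hbe
    have hqa : q ∣ a :=
      (hq.prime.dvd_or_dvd (h' ▸ hqd.mul_left b : q ∣ a * e)).resolve_right he
    exact hq.not_isUnit (hc.isUnit_of_dvd' hqa hqd)

/-- The `t`-proper fractions, as a subspace over `K`. -/
def properSubmodule (ht : Transcendental K t) : Submodule K E where
  carrier := {f | IsProper K t f}
  zero_mem' := ⟨0, 1, by simp, by simp⟩
  add_mem' := by
    rintro f g ⟨a, d, had, rfl⟩ ⟨b, e, hbe, rfl⟩
    have hd : d ≠ 0 := by
      rintro rfl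
      simp at had
    have he : e ≠ 0 := by
      rintro rfl
      simp at hbe
    refine ⟨a * e + d * b, d * e, ?_, ?_⟩
    · refine (degree_add_le _ _).trans_lt (max_lt ?_ ?_)
      · rw [degree_mul, degree_mul]
        exact WithBot.add_lt_add_right (degree_ne_bot.2 he) had
      · rw [degree_mul, degree_mul]
        exact WithBot.add_lt_add_left (degree_ne_bot.2 hd) hbe
    · simp only [map_add, map_mul]
      rw [div_add_div _ _ (aeval_ne_zero_of_transcendental ht hd)
        (aeval_ne_zero_of_transcendental ht he)]
  smul_mem' := by
    rintro c f ⟨a, d, had, rfl⟩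
    refine ⟨c • a, d, (degree_smul_le c a).trans_lt had, ?_⟩
    rw [map_smul, smul_div_assoc]

theorem IsProper.isFraction {f : E} (hf : IsProper K t f) : IsFraction K t f := by
  obtain ⟨a, d, had, rfl⟩ := hf
  refine ⟨a, d, ?_, rfl⟩
  rintro rfl
  simp at had

theorem eq_zero_of_isProper_aeval (ht : Transcendental K t) {p : K[X]}
    (hp : IsProper K t (aeval t p)) : p = 0 := by
  obtain ⟨a, d, had, h⟩ := hp
  have hd : d ≠ 0 := by
    rintro rfl
    simp at had
  rw [eq_div_iff (aeval_ne_zero_of_transcendental ht hd), ← map_mul] at h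
  have h' := aeval_injective_of_transcendental ht h
  by_contra hp0
  rw [← h', degree_mul] at had
  rw [degree_eq_natDegree hp0, degree_eq_natDegree hd] at had
  norm_cast at had
  omega

theorem IsFraction.exists_add_isProper (ht : Transcendental K t) {f : E}
    (hf : IsFraction K t f) : ∃ (p : K[X]) (h : E), IsProper K t h ∧ f = aeval t p + h := by
  obtain ⟨a, d, hd, rfl⟩ := hf
  have hd' := aeval_ne_zero_of_transcendental ht hd
  refine ⟨a / d, aeval t (a % d) / aeval t d, ⟨a % d, d, ?_, rfl⟩, ?_⟩
  · exact EuclideanDomain.mod_lt a hd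
  · conv_lhs => rw [← EuclideanDomain.div_add_mod a d, map_add, map_mul, add_div,
      mul_div_cancel_left₀ _ hd']

theorem aeval_mem_of_monomial_mem (N : AddSubgroup E)
    (hpoly : ∀ (a : K) (i : ℕ), (a : E) * t ^ i ∈ N) (p : K[X]) : aeval t p ∈ N := by
  induction p using Polynomial.induction_on' with
  | add p q hp hq =>
    rw [map_add]
    exact N.add_mem hp hq
  | monomial i a =>
    rw [aeval_monomial]
    exact hpoly a i

/-- Partial fraction decomposition, as an induction principle. -/
theorem IsFraction.mem_of_partial_fractions (ht : Transcendental K t) (N : AddSubgroup E)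
    (hpoly : ∀ (a : K) (i : ℕ), (a : E) * t ^ i ∈ N)
    (hfrac : ∀ (r q : K[X]) (j : ℕ), q.Monic → Irreducible q → r.degree < q.degree →
      aeval t r / aeval t q ^ (j + 1) ∈ N)
    {f : E} (hf : IsFraction K t f) : f ∈ N := by
  -- Repeated division of the numerator by q peels off its q-adic digits.
  have hpow : ∀ (q : K[X]), q.Monic → Irreducible q → ∀ (j : ℕ) (a : K[X]),
      aeval t a / aeval t q ^ j ∈ N := by
    intro q hm hq j
    have hq' := aeval_ne_zero_of_transcendental ht hq.ne_zero
    induction j with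
    | zero => exact fun a => by simpa using aeval_mem_of_monomial_mem N hpoly a
    | succ j ih =>
      intro a
      have h : aeval t a / aeval t q ^ (j + 1)
          = aeval t (a / q) / aeval t q ^ j + aeval t (a % q) / aeval t q ^ (j + 1) := by
        conv_lhs => rw [← EuclideanDomain.div_add_mod a q, map_add, map_mul, add_div]
        congr 1
        rw [pow_succ', mul_div_mul_left _ _ hq']
      rw [h]
      exact N.add_mem (ih _) (hfrac _ q j hm hq (EuclideanDomain.mod_lt a hq.ne_zero))
  -- Bézout splits a denominator into coprime factors; for a prime power, the unit making the prime
  -- monic is absorbed in the numerator.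
  have key : ∀ d : K[X], d ≠ 0 → ∀ a : K[X], aeval t a / aeval t d ∈ N := by
    classical
    intro d
    induction d using UniqueFactorizationMonoid.induction_on_coprime with
    | h0 => exact fun h => absurd rfl h
    | @h1 x hu =>
      intro hd a
      obtain ⟨e, he⟩ := hu.exists_right_inv
      have h : aeval t a / aeval t x = aeval t (a * e) := by
        rw [div_eq_iff (aeval_ne_zero_of_transcendental ht hd), ← map_mul]
        congr 1
        rw [mul_assoc, mul_comm e, he, mul_one]
      rw [h]
      exact aeval_mem_of_monomial_mem N hpoly _
    | @hpr p j hp =>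
      intro hd a
      have hp0 := hp.ne_zero
      obtain ⟨u, hu⟩ := normalize_associated p
      have hup : normalize p ^ j * (u : K[X]) ^ j = p ^ j := by rw [← mul_pow, hu]
      have hu0 : (u : K[X]) ^ j ≠ 0 := pow_ne_zero _ u.ne_zero
      obtain ⟨e, he⟩ := (u.isUnit.pow j).exists_right_inv
      have h : aeval t a / aeval t (p ^ j) = aeval t (a * e) / aeval t (normalize p) ^ j := by
        have hn : normalize p ≠ 0 := normalize_eq_zero.not.2 hp0
        rw [← map_pow, div_eq_div_iff (aeval_ne_zero_of_transcendental ht hd)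
          (aeval_ne_zero_of_transcendental ht (pow_ne_zero _ hn)), ← map_mul, ← map_mul, ← hup]
        congr 1
        calc a * normalize p ^ j = a * ((u : K[X]) ^ j * e) * normalize p ^ j := by
              rw [he, mul_one]
          _ = a * e * (normalize p ^ j * (u : K[X]) ^ j) := by ring
      rw [h]
      exact hpow _ (monic_normalize hp0)
        ((normalize_associated p).symm.irreducible hp.irreducible) j _
    | @hcp x y hxy hx hy =>
      intro hd a
      have hx0 : x ≠ 0 := left_ne_zero_of_mul hd
      have hy0 : y ≠ 0 := right_ne_zero_of_mul hd
      obtain ⟨u, v, huv⟩ := hxy.isCoprime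
      have h : aeval t a / aeval t (x * y) = aeval t (a * v) / aeval t x
          + aeval t (a * u) / aeval t y := by
        rw [div_add_div _ _ (aeval_ne_zero_of_transcendental ht hx0)
          (aeval_ne_zero_of_transcendental ht hy0), ← map_mul, ← map_mul, ← map_mul, ← map_add]
        congr 2
        calc a = a * (u * x + v * y) := by rw [huv, mul_one]
          _ = _ := by ring
      rw [h]
      exact N.add_mem (hx hx0 _) (hy hy0 _)
  obtain ⟨a, d, hd, rfl⟩ := hf
  exact key d hd a

theorem isFraction_aeval (p : K[X]) : IsFraction K t (aeval t p) :=
  ⟨p, 1, one_ne_zero, by simp⟩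

end Fractions

end SigmaReduction

namespace SigmaReduction

/-! ### The canonical basis of one extension. -/

section StepBasis

variable {k E : Type*} [Field k] [Field E] [Algebra k E] {K : IntermediateField k E} {t : E}

/-- The canonical basis of `K(t)` over `K` as an indexed family. -/
noncomputable def stepFamily (K : IntermediateField k E) (t : E) :
    ℕ ⊕ (Σ q : {q : K[X] // q.Monic ∧ Irreducible q}, ℕ × Fin q.1.natDegree) → E :=
  Sum.elim (fun i => t ^ i) (fun x => t ^ (x.2.2 : ℕ) / aeval t x.1.1 ^ (x.2.1 + 1))

theorem range_stepFamily : Set.range (stepFamily K t) = stepBasis K t := by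
  ext θ
  constructor
  · rintro ⟨i | ⟨⟨q, hm, hq⟩, j, i⟩, rfl⟩
    · exact Or.inl ⟨i, rfl⟩
    · exact Or.inr ⟨q, i, j + 1, hm, hq, i.2, by omega, rfl⟩
  · rintro (⟨i, rfl⟩ | ⟨q, i, j, hm, hq, hi, hj, rfl⟩)
    · exact ⟨Sum.inl i, rfl⟩
    · obtain ⟨j, rfl⟩ := Nat.exists_eq_add_of_le' hj
      exact ⟨Sum.inr ⟨⟨q, hm, hq⟩, j, ⟨i, hi⟩⟩, rfl⟩

theorem regularAt_div_pow {q p : K[X]} (hqm : q.Monic) (hpm : p.Monic)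
    (hq : Irreducible q) (hp : Irreducible p) (hne : q ≠ p) (r : K[X]) (j : ℕ) :
    RegularAt K t q (aeval t r / aeval t p ^ j) := by
  refine ⟨r, p ^ j, fun h => hne ?_, by rw [map_pow]⟩
  exact eq_of_monic_of_associated hqm hpm
    (hq.associated_of_dvd hp (hq.prime.dvd_of_dvd_pow h))

/-- Index j stands for the exponent j + 1. If J is the largest index of q in a relation, multiplying
by q^J makes every term outside level J of q regular at q. That level becomes r / q with deg r < deg
q, so q divides r and r = 0. Once all fractions are gone, transcendence of t settles the powers. -/
theorem linearIndependent_stepFamily (ht : Transcendental K t) :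
    LinearIndependent K (stepFamily K t) := by
  classical
  rw [linearIndependent_iff']
  intro s g hg
  have hfrac : ∀ x, Sum.inr x ∈ s → g (Sum.inr x) = 0 := by
    by_contra! hbad
    obtain ⟨⟨⟨q, hqm, hq⟩, j₁, i₁⟩, hx₁s, hx₁⟩ := hbad
    let lev : ℕ ⊕ (Σ q : {q : K[X] // q.Monic ∧ Irreducible q}, ℕ × Fin q.1.natDegree) → ℕ :=
      Sum.elim (fun _ => 0) (fun x => x.2.1)
    obtain ⟨x₀, hx₀, hmax⟩ := Finset.exists_max_image
      (s.filter fun x => g x ≠ 0 ∧ ∃ y : ℕ × Fin q.natDegree, x = Sum.inr ⟨⟨q, hqm, hq⟩, y⟩) lev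
      ⟨_, Finset.mem_filter.2 ⟨hx₁s, hx₁, _, rfl⟩⟩
    rw [Finset.mem_filter] at hx₀
    obtain ⟨hx₀s, hx₀g, ⟨J, i₀⟩, rfl⟩ := hx₀
    have hq' := aeval_ne_zero_of_transcendental ht hq.ne_zero
    let blk : ℕ ⊕ (Σ q : {q : K[X] // q.Monic ∧ Irreducible q}, ℕ × Fin q.1.natDegree) → Prop :=
      fun x => ∃ i : Fin q.natDegree, x = Sum.inr ⟨⟨q, hqm, hq⟩, J, i⟩
    let e : ℕ ⊕ (Σ q : {q : K[X] // q.Monic ∧ Irreducible q}, ℕ × Fin q.1.natDegree) → ℕ :=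
      Sum.elim (fun i => i) (fun x => x.2.2)
    let r : K[X] := ∑ x ∈ s.filter blk, C (g x) * X ^ e x
    have hr : ∑ x ∈ s.filter blk, g x • stepFamily K t x * aeval t q ^ J
        = aeval t r / aeval t q := by
      rw [map_sum, Finset.sum_div]
      refine Finset.sum_congr rfl fun x hx => ?_
      obtain ⟨-, i, rfl⟩ := Finset.mem_filter.1 hx
      simp only [stepFamily, Sum.elim_inr, map_mul, aeval_C, map_pow, aeval_X, e,
        Algebra.smul_def]
      rw [pow_succ]
      field_simp
    have hreg : RegularAt K t q
        (∑ x ∈ s.filter (fun x => ¬ blk x), g x • stepFamily K t x * aeval t q ^ J) := by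
      refine RegularAt.sum ht hq fun x hx => ?_
      rw [Finset.mem_filter] at hx
      by_cases hgx : g x = 0
      · rw [hgx, zero_smul, zero_mul]
        simpa using regularAt_aeval (t := t) hq 0
      obtain i | ⟨⟨p, hpm, hp⟩, j, i⟩ := x
      · convert regularAt_aeval (t := t) hq (C (g (Sum.inl i)) * X ^ i * q ^ J) using 1
        simp [stepFamily, Algebra.smul_def]
      · by_cases hpq : q = p
        · subst hpq
          have hjJ : j ≤ J := hmax _ (Finset.mem_filter.2 ⟨hx.1, hgx, _, rfl⟩)
          have hne : j ≠ J := by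
            rintro rfl
            exact hx.2 ⟨i, rfl⟩
          obtain ⟨m, rfl⟩ := Nat.exists_eq_add_of_le (Nat.lt_of_le_of_ne hjJ hne)
          convert regularAt_aeval (t := t) hq
            (C (g (Sum.inr ⟨⟨q, hpm, hp⟩, j, i⟩)) * X ^ (i : ℕ) * q ^ m) using 1
          simp only [stepFamily, Sum.elim_inr, map_mul, aeval_C, map_pow, aeval_X,
            Algebra.smul_def]
          rw [Nat.succ_eq_add_one, pow_add _ (j + 1) m]
          field_simp
        · convert (regularAt_div_pow (t := t) hqm hpm hq hp hpq
            (C (g (Sum.inr ⟨⟨p, hpm, hp⟩, j, i⟩)) * X ^ (i : ℕ)) (j + 1)).mul hq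
            (regularAt_aeval hq (q ^ J)) using 1
          simp only [stepFamily, Sum.elim_inr, map_mul, aeval_C, map_pow, aeval_X,
            Algebra.smul_def]
          ring
    have hsum : aeval t r / aeval t q
        = -∑ x ∈ s.filter (fun x => ¬ blk x), g x • stepFamily K t x * aeval t q ^ J := by
      rw [← hr, eq_neg_iff_add_eq_zero, Finset.sum_filter_add_sum_filter_not, ← Finset.sum_mul,
        hg, zero_mul]
    have hdvd : q ∣ r := dvd_of_regularAt_div ht hq (hsum ▸ hreg.neg)
    have hdeg : r.degree < q.degree := by
      refine (degree_sum_le _ _).trans_lt ((Finset.sup_lt_iff ?_).2 fun x hx => ?_)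
      · exact bot_lt_iff_ne_bot.2 (degree_ne_bot.2 hq.ne_zero)
      · obtain ⟨-, i, rfl⟩ := Finset.mem_filter.1 hx
        refine (degree_C_mul_X_pow_le _ _).trans_lt ?_
        rw [degree_eq_natDegree hq.ne_zero]
        exact_mod_cast i.2
    have hr0 : r = 0 := eq_zero_of_dvd_of_degree_lt hdvd hdeg
    have hcoeff : r.coeff i₀ = g (Sum.inr ⟨⟨q, hqm, hq⟩, J, i₀⟩) := by
      rw [finsetSum_coeff, Finset.sum_eq_single (Sum.inr ⟨⟨q, hqm, hq⟩, J, i₀⟩)]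
      · simp [e]
      · intro x hx hne
        obtain ⟨-, i, rfl⟩ := Finset.mem_filter.1 hx
        rw [coeff_C_mul_X_pow, if_neg]
        intro h
        exact hne (by rw [Fin.ext h])
      · intro h
        exact absurd (Finset.mem_filter.2 ⟨hx₀s, i₀, rfl⟩) h
    rw [hr0, coeff_zero] at hcoeff
    exact hx₀g hcoeff.symm
  let p : K[X] := ∑ x ∈ s, Sum.elim (fun i => C (g (Sum.inl i)) * X ^ i) (fun _ => 0) x
  have hp : p = 0 := by
    refine transcendental_iff.1 ht p ?_
    rw [map_sum, ← hg]
    refine Finset.sum_congr rfl fun x hx => ?_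
    obtain i | x := x
    · simp [stepFamily, Algebra.smul_def]
    · rw [hfrac x hx]
      simp
  rintro (i | x) hx
  · have hcoeff : p.coeff i = g (Sum.inl i) := by
      rw [finsetSum_coeff, Finset.sum_eq_single (Sum.inl i)]
      · simp
      · rintro (i' | x) _ hne
        · rw [Sum.elim_inl, coeff_C_mul_X_pow, if_neg]
          rintro rfl
          exact hne rfl
        · simp
      · intro h
        exact absurd hx h
    rw [← hcoeff, hp, coeff_zero]
  · exact hfrac x hx

theorem linearIndepOn_stepBasis (ht : Transcendental K t) :
    LinearIndepOn K id (stepBasis K t) := by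
  rw [← range_stepFamily]
  exact (linearIndependent_stepFamily ht).linearIndepOn_id

theorem IsFraction.mem_span_stepBasis (ht : Transcendental K t) {f : E}
    (hf : IsFraction K t f) : f ∈ Submodule.span K (stepBasis K t) := by
  refine hf.mem_of_partial_fractions ht (Submodule.span K (stepBasis K t)).toAddSubgroup
    (fun a i => ?_) (fun r q j hm hq hr => ?_)
  · exact Submodule.smul_mem _ a (Submodule.subset_span (Or.inl ⟨i, rfl⟩))
  · have hr' : r.natDegree < q.natDegree := by
      by_cases h0 : r = 0
      · rw [h0, natDegree_zero]
        exact hq.natDegree_pos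
      · exact natDegree_lt_natDegree h0 hr
    rw [Submodule.mem_toAddSubgroup, aeval_eq_sum_range' hr', Finset.sum_div]
    refine Submodule.sum_mem _ fun i hi => ?_
    rw [smul_div_assoc]
    exact Submodule.smul_mem _ _ (Submodule.subset_span
      (Or.inr ⟨q, i, j + 1, hm, hq, Finset.mem_range.1 hi, by omega, rfl⟩))

/-- The products of a `k`-basis of `K` and a linearly independent set over `K`. -/
theorem linearIndepOn_mul {A : Set E} (hAK : A ⊆ K) (hA : LinearIndepOn k id A) {B : Set E}
    (hB : LinearIndepOn K id B) : LinearIndepOn k id {x : E | ∃ a ∈ A, ∃ b ∈ B, x = a * b} := by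
  have hA' : LinearIndependent k (fun a : A => (⟨a, hAK a.2⟩ : K)) := by
    refine LinearIndependent.of_comp K.val.toLinearMap ?_
    exact hA
  have h := (linearIndependent_smul hA' hB).linearIndepOn_id
  convert h using 1
  ext x
  constructor
  · rintro ⟨a, ha, b, hb, rfl⟩
    exact ⟨(⟨a, ha⟩, ⟨b, hb⟩), rfl⟩
  · rintro ⟨⟨⟨a, ha⟩, ⟨b, hb⟩⟩, rfl⟩
    exact ⟨a, ha, b, hb, rfl⟩

theorem mem_span_mul {A : Set E}
    (hA : ∀ x ∈ K, x ∈ Submodule.span k A) {B : Set E} {f : E}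
    (hf : f ∈ Submodule.span K B) :
    f ∈ Submodule.span k {x : E | ∃ a ∈ A, ∃ b ∈ B, x = a * b} := by
  refine Submodule.closure_induction (p := fun f _ => f ∈ Submodule.span k
    {x : E | ∃ a ∈ A, ∃ b ∈ B, x = a * b}) (Submodule.zero_mem _)
    (fun _ _ _ _ => Submodule.add_mem _) (fun c b hb => ?_) hf
  have hmap : Submodule.span k A ≤ (Submodule.span k
      {x : E | ∃ a ∈ A, ∃ b ∈ B, x = a * b}).comap (LinearMap.mulRight k b) :=
    Submodule.span_le.2 fun a ha => Submodule.subset_span ⟨a, ha, b, hb, rfl⟩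
  exact hmap (hA c c.2)

theorem mem_adjoin_insert_iff_isFraction {f : E} :
    f ∈ IntermediateField.adjoin k (insert t (K : Set E)) ↔ IsFraction K t f := by
  constructor
  · intro hf
    have h : f ∈ IntermediateField.adjoin K {t} := by
      rw [← IntermediateField.mem_restrictScalars k, IntermediateField.restrictScalars_adjoin]
      rwa [Set.union_singleton]
    obtain ⟨r, s, rfl⟩ := (IntermediateField.mem_adjoin_simple_iff K f).1 h
    -- Division by zero yields 0, which needs a genuine denominator.
    by_cases hs : s = 0
    · exact ⟨0, 1, one_ne_zero, by simp [hs]⟩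
    · exact ⟨r, s, hs, rfl⟩
  · intro hf
    have hK : ∀ a : K, (a : E) ∈ IntermediateField.adjoin k (insert t (K : Set E)) := fun a =>
      IntermediateField.subset_adjoin k _ (Set.mem_insert_of_mem _ a.2)
    have ht' : t ∈ IntermediateField.adjoin k (insert t (K : Set E)) :=
      IntermediateField.subset_adjoin k _ (Set.mem_insert _ _)
    obtain ⟨a, d, -, rfl⟩ := hf
    have hp := aeval_mem_of_monomial_mem (K := K) (t := t)
      (IntermediateField.adjoin k (insert t (K : Set E))).toSubfield.toAddSubgroup
      (fun a i => show _ ∈ IntermediateField.adjoin k (insert t (K : Set E)) from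
        mul_mem (hK a) (pow_mem ht' i))
    exact div_mem (hp a) (hp d)

end StepBasis

end SigmaReduction

namespace SigmaReduction

/-! ### The action of σ and its powers on K[t]. -/

section Shift

variable {k E : Type*} [Field k] [Field E] [Algebra k E] {K : IntermediateField k E} {t : E}

/-- `τ` restricts to an automorphism of `K` and maps `t` to `t + β` for some `β` in `K`. -/
def IsShift (K : IntermediateField k E) (t : E) (τ : E ≃+* E) : Prop :=
  (∀ x, τ x ∈ K ↔ x ∈ K) ∧ τ t - t ∈ K

theorem IsShift.one : IsShift K t 1 :=
  ⟨fun _ => Iff.rfl, by rw [RingAut.one_apply, sub_self]; exact K.zero_mem⟩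

theorem IsShift.mul {τ υ : E ≃+* E} (hτ : IsShift K t τ) (hυ : IsShift K t υ) :
    IsShift K t (τ * υ) := by
  refine ⟨fun x => ?_, ?_⟩
  · rw [RingAut.mul_apply, hτ.1, hυ.1]
  · have h : (τ * υ) t - t = τ (υ t - t) + (τ t - t) := by
      rw [RingAut.mul_apply, map_sub]
      ring
    rw [h]
    exact K.add_mem ((hτ.1 _).2 hυ.2) hτ.2

theorem IsShift.inv {τ : E ≃+* E} (hτ : IsShift K t τ) : IsShift K t τ⁻¹ := by
  have h : ∀ x, τ (τ⁻¹ x) = x := fun x => τ.apply_symm_apply x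
  refine ⟨fun x => ?_, ?_⟩
  · rw [← hτ.1, h]
  · rw [← hτ.1, map_sub, h, ← neg_sub]
    exact K.neg_mem hτ.2

theorem IsShift.zpow {τ : E ≃+* E} (hτ : IsShift K t τ) (l : ℤ) : IsShift K t (τ ^ l) := by
  induction l using Int.induction_on with
  | zero => exact IsShift.one
  | succ i ih => rw [zpow_add_one]; exact ih.mul hτ
  | pred i ih => rw [zpow_sub_one]; exact ih.mul hτ.inv

/-- The restriction of `τ` to `K`. -/
def IsShift.restrict {τ : E ≃+* E} (hτ : IsShift K t τ) : K ≃+* K where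
  toFun x := ⟨τ x, (hτ.1 x).2 x.2⟩
  invFun x := ⟨τ.symm x, (hτ.1 _).1 (by rw [RingEquiv.apply_symm_apply]; exact x.2)⟩
  left_inv x := Subtype.ext (τ.symm_apply_apply x)
  right_inv x := Subtype.ext (τ.apply_symm_apply x)
  map_mul' x y := Subtype.ext (map_mul τ (x : E) y)
  map_add' x y := Subtype.ext (map_add τ (x : E) y)

@[simp]
theorem IsShift.coe_restrict {τ : E ≃+* E} (hτ : IsShift K t τ) (x : K) :
    (hτ.restrict x : E) = τ x := rfl

/-- The action of `τ` on `K[t]`. -/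
noncomputable def IsShift.poly {τ : E ≃+* E} (hτ : IsShift K t τ) : K[X] ≃+* K[X] :=
  (mapEquiv hτ.restrict).trans (taylorEquiv (⟨τ t - t, hτ.2⟩ : K)).toRingEquiv

theorem IsShift.poly_apply {τ : E ≃+* E} (hτ : IsShift K t τ) (p : K[X]) :
    hτ.poly p = taylor (⟨τ t - t, hτ.2⟩ : K) (p.map (hτ.restrict : K →+* K)) := rfl

theorem IsShift.aeval_poly {τ : E ≃+* E} (hτ : IsShift K t τ) (p : K[X]) :
    aeval t (hτ.poly p) = τ (aeval t p) := by
  induction p using Polynomial.induction_on' with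
  | add p q hp hq => rw [map_add, map_add, map_add, map_add, hp, hq]
  | monomial i a =>
    rw [hτ.poly_apply, map_monomial, taylor_monomial, aeval_monomial, map_mul, map_mul, aeval_C,
      map_pow, map_pow, map_add, aeval_X, aeval_C]
    exact congrArg (fun x => τ a * x ^ i) (add_sub_cancel t (τ t))

theorem IsShift.degree_poly {τ : E ≃+* E} (hτ : IsShift K t τ) (p : K[X]) :
    (hτ.poly p).degree = p.degree := by
  rw [hτ.poly_apply, degree_taylor, degree_map]

theorem IsShift.natDegree_poly {τ : E ≃+* E} (hτ : IsShift K t τ) (p : K[X]) :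
    (hτ.poly p).natDegree = p.natDegree := natDegree_eq_of_degree_eq (hτ.degree_poly p)

theorem IsShift.monic_poly {τ : E ≃+* E} (hτ : IsShift K t τ) {p : K[X]} (hp : p.Monic) :
    (hτ.poly p).Monic := by
  rw [Monic, hτ.poly_apply, leadingCoeff_taylor]
  exact hp.map _

theorem IsShift.irreducible_poly {τ : E ≃+* E} (hτ : IsShift K t τ) {p : K[X]}
    (hp : Irreducible p) : Irreducible (hτ.poly p) :=
  (MulEquiv.irreducible_iff hτ.poly).2 hp

/-- The d-th Taylor coefficient is a value of the d-th Hasse derivative, which is linear under this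
degree bound. Both the infinitude of orbits and the polynomial reduction use this formula. -/
theorem IsShift.coeff_poly {τ : E ≃+* E} (hτ : IsShift K t τ) {p : K[X]} {d : ℕ}
    (hp : p.natDegree ≤ d + 1) :
    ((hτ.poly p).coeff d : E)
      = τ (p.coeff d) + (d + 1) * τ (p.coeff (d + 1)) * (τ t - t) := by
  have hp' : (p.map (hτ.restrict : K →+* K)).natDegree ≤ d + 1 := natDegree_map_le.trans hp
  have h : hasseDeriv d (p.map (hτ.restrict : K →+* K))
      = C (hτ.restrict (p.coeff d)) + C ((d + 1) * hτ.restrict (p.coeff (d + 1))) * X := by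
    ext1 m
    rw [hasseDeriv_coeff, coeff_map]
    match m with
    | 0 => simp
    | 1 =>
      rw [add_comm 1 d, coeff_add, coeff_C, coeff_C_mul, coeff_X_one, Nat.choose_succ_self_right]
      simp
    | m + 2 =>
      rw [coeff_eq_zero_of_natDegree_lt (p := p) (by omega)]
      rw [coeff_add, coeff_C_mul, coeff_X_of_ne_one (by omega), coeff_C_of_ne_zero (by omega)]
      simp
  rw [hτ.poly_apply, taylor_coeff, h]
  simp

theorem IsShift.coeff_poly_of_natDegree_le {τ : E ≃+* E} (hτ : IsShift K t τ) {p : K[X]} {d : ℕ}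
    (hp : p.natDegree ≤ d) : ((hτ.poly p).coeff d : E) = τ (p.coeff d) := by
  rw [hτ.coeff_poly (hp.trans (Nat.le_succ d)),
    coeff_eq_zero_of_natDegree_lt (p := p) (Nat.lt_succ_of_le hp)]
  simp

theorem IsShift.regularAt {τ : E ≃+* E} (hτ : IsShift K t τ) {q : K[X]} {f : E}
    (hf : RegularAt K t q f) : RegularAt K t (hτ.poly q) (τ f) := by
  obtain ⟨a, d, hd, rfl⟩ := hf
  refine ⟨hτ.poly a, hτ.poly d, fun h => hd ((map_dvd_iff hτ.poly).1 h), ?_⟩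
  rw [hτ.aeval_poly, hτ.aeval_poly, map_div₀]

theorem IsShift.isFraction {τ : E ≃+* E} (hτ : IsShift K t τ) {f : E}
    (hf : IsFraction K t f) : IsFraction K t (τ f) := by
  obtain ⟨a, d, hd, rfl⟩ := hf
  refine ⟨hτ.poly a, hτ.poly d, (map_ne_zero_iff _ hτ.poly.injective).2 hd, ?_⟩
  rw [hτ.aeval_poly, hτ.aeval_poly, map_div₀]

theorem IsShift.isProper {τ : E ≃+* E} (hτ : IsShift K t τ) {f : E}
    (hf : IsProper K t f) : IsProper K t (τ f) := by
  obtain ⟨a, d, had, rfl⟩ := hf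
  refine ⟨hτ.poly a, hτ.poly d, by rwa [hτ.degree_poly, hτ.degree_poly], ?_⟩
  rw [hτ.aeval_poly, hτ.aeval_poly, map_div₀]

/-- If `t` differs from an element fixed by a positive power of `σ` by an element of `K`, then `t`
lies in `K`, because the trace of that element is a constant. -/
theorem mem_of_pow_fixed [CharZero E] {σ : E ≃+* E} (hC : ∀ x, σ x = x → x ∈ K)
    (hσ : IsShift K t σ) {h : E} (hh : h - t ∈ K) {l : ℕ} (hl : l ≠ 0) (hfix : (σ ^ l) h = h) :
    t ∈ K := by
  have hmem : ∀ i : ℕ, (σ ^ i) h - t ∈ K := by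
    intro i
    have hi := hσ.zpow i
    rw [zpow_natCast] at hi
    have e : (σ ^ i) h - t = (σ ^ i) (h - t) + ((σ ^ i) t - t) := by
      rw [map_sub]
      ring
    rw [e]
    exact K.add_mem ((hi.1 _).2 hh) hi.2
  have htr : ∑ i ∈ Finset.range l, (σ ^ i) h ∈ K := by
    refine hC _ ?_
    rw [map_sum]
    have e : ∀ i, σ ((σ ^ i) h) = (σ ^ (i + 1)) h := fun i => by
      rw [pow_succ', RingAut.mul_apply]
    simp only [e]
    -- Adding σ^l h at the end or h at the start gives the same sum, as these terms agree.
    have e1 := Finset.sum_range_succ (fun i => (σ ^ i) h) l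
    have e2 := Finset.sum_range_succ' (fun i => (σ ^ i) h) l
    rw [e1, hfix, pow_zero, RingAut.one_apply] at e2
    exact (add_right_cancel e2).symm
  have hsum : ∑ i ∈ Finset.range l, ((σ ^ i) h - t) ∈ K := sum_mem fun i _ => hmem i
  have hlt : (l : E) * t ∈ K := by
    rw [Finset.sum_sub_distrib, Finset.sum_const, Finset.card_range, nsmul_eq_mul] at hsum
    simpa using K.sub_mem htr hsum
  have hl' : (l : E) ≠ 0 := Nat.cast_ne_zero.2 hl
  have := K.mul_mem (K.inv_mem (natCast_mem K l)) hlt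
  rwa [inv_mul_cancel_left₀ hl'] at this

theorem not_mem_of_transcendental (ht : Transcendental K t) : t ∉ K := fun h =>
  ht (isAlgebraic_algebraMap (⟨t, h⟩ : K))

/-- With deg p = m + 1, comparing coefficients of t^m shows that t + p_m/(m+1), that is, t minus the
mean of the roots of p, is fixed by σ^l. For l ≠ 0, `mem_of_pow_fixed` would then place t in K. -/
theorem eq_zero_of_zpow_fixed [CharZero E] (ht : Transcendental K t) {σ : E ≃+* E}
    (hC : ∀ x, σ x = x → x ∈ K) (hσ : IsShift K t σ) {p : K[X]} (hm : p.Monic)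
    (hp : Irreducible p) {l : ℤ} (hfix : (σ ^ l) (aeval t p) = aeval t p) : l = 0 := by
  obtain ⟨m, hpm⟩ := Nat.exists_eq_succ_of_ne_zero hp.natDegree_pos.ne'
  have hm1 : ((m : E) + 1) ≠ 0 := by exact_mod_cast Nat.succ_ne_zero m
  have hfix' : (σ ^ l) (t + p.coeff m / (m + 1)) = t + p.coeff m / (m + 1) := by
    have hl := hσ.zpow l
    rw [← hl.aeval_poly] at hfix
    have hpp := aeval_injective_of_transcendental ht hfix
    have hc := hl.coeff_poly (d := m) hpm.le
    have h1 : p.coeff (m + 1) = 1 := by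
      rw [← Nat.succ_eq_add_one, ← hpm]
      exact hm.coeff_natDegree
    rw [hpp, h1] at hc
    rw [map_add, map_div₀, map_add, map_natCast, map_one]
    simp only [OneMemClass.coe_one, map_one, mul_one] at hc
    field_simp
    linear_combination -hc
  have hh : (t + p.coeff m / (m + 1) : E) - t ∈ K := by
    rw [add_sub_cancel_left]
    exact K.div_mem (p.coeff m).2 (K.add_mem (natCast_mem K m) K.one_mem)
  by_contra hl
  refine not_mem_of_transcendental ht (mem_of_pow_fixed hC hσ hh (Int.natAbs_ne_zero.2 hl) ?_)
  rcases Int.natAbs_eq l with h | h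
  · rw [h, zpow_natCast] at hfix'
    exact hfix'
  · rw [h, zpow_neg, zpow_natCast] at hfix'
    conv_lhs => rw [← hfix']
    exact (σ ^ l.natAbs).apply_symm_apply _

end Shift

end SigmaReduction

namespace SigmaReduction

/-! ### Orbits of irreducibles and the complement U_S. -/

section Decomposition

variable {k E : Type*} [Field k] [Field E] [Algebra k E] {K : IntermediateField k E} {t : E}

theorem exists_eq_aeval_of_mem_closure {S : Set E} (hS : S ⊆ monicIrreducibles K t) {d : E}
    (hd : d ∈ Submonoid.closure S) : ∃ e : K[X], e.Monic ∧ d = aeval t e := by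
  induction hd using Submonoid.closure_induction with
  | mem d hd =>
    obtain ⟨q, hm, -, rfl⟩ := hS hd
    exact ⟨q, hm, rfl⟩
  | one => exact ⟨1, monic_one, by simp⟩
  | mul x y _ _ hx hy =>
    obtain ⟨e, he, rfl⟩ := hx
    obtain ⟨e', he', rfl⟩ := hy
    exact ⟨e * e', he.mul he', (map_mul _ _ _).symm⟩

/-- `U_S` as a subspace. -/
def properComplementSubmodule (ht : Transcendental K t) {S : Set E}
    (hS : S ⊆ monicIrreducibles K t) : Submodule k E where
  carrier := properComplement K t S
  zero_mem' := ⟨(properSubmodule ht).zero_mem, 0, 1, Submonoid.one_mem _, by simp⟩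
  add_mem' := by
    rintro f g ⟨hf, a, d, hd, hfa⟩ ⟨hg, b, e, he, hgb⟩
    refine ⟨(properSubmodule ht).add_mem hf hg, ?_⟩
    obtain ⟨d', hdm, hd'⟩ := exists_eq_aeval_of_mem_closure hS hd
    obtain ⟨e', hem, he'⟩ := exists_eq_aeval_of_mem_closure hS he
    refine ⟨a * e' + d' * b, d * e, Submonoid.mul_mem _ hd he, ?_⟩
    have hd0 : d ≠ 0 := hd' ▸ aeval_ne_zero_of_transcendental ht hdm.ne_zero
    have he0 : e ≠ 0 := he' ▸ aeval_ne_zero_of_transcendental ht hem.ne_zero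
    rw [hfa, hgb, div_add_div _ _ hd0 he0, map_add, map_mul, map_mul, ← hd', ← he']
  smul_mem' := by
    rintro c f ⟨hf, a, d, hd, hfa⟩
    refine ⟨?_, algebraMap k K c • a, d, hd, ?_⟩
    · rw [← algebraMap_smul K c f]
      exact (properSubmodule ht).smul_mem _ hf
    · rw [hfa, map_smul, algebraMap_smul, smul_div_assoc]

/-- The polynomials with coefficients in the subspace `W` of `K`. -/
def polySubmodule (t : E) (W : Submodule k K) : Submodule k E where
  carrier := {f | ∃ p : K[X], (∀ i, p.coeff i ∈ W) ∧ f = aeval t p}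
  zero_mem' := ⟨0, fun i => by rw [coeff_zero]; exact W.zero_mem, by simp⟩
  add_mem' := by
    rintro f g ⟨p, hp, rfl⟩ ⟨q, hq, rfl⟩
    exact ⟨p + q, fun i => by rw [coeff_add]; exact W.add_mem (hp i) (hq i),
      (map_add _ _ _).symm⟩
  smul_mem' := by
    rintro c f ⟨p, hp, rfl⟩
    refine ⟨algebraMap k K c • p, fun i => ?_, by rw [map_smul, algebraMap_smul]⟩
    rw [coeff_smul, algebraMap_smul]
    exact W.smul_mem c (hp i)

variable {σ : E ≃+* E}

theorem exists_zpow_eq_of_mem_monicIrreducibles (ht : Transcendental K t) (hσ : IsShift K t σ)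
    {S : Set E} (hS : IsRepresentativeSet σ K t S) {q : K[X]} (hm : q.Monic)
    (hq : Irreducible q) :
    ∃ (p : K[X]) (l : ℤ), p.Monic ∧ Irreducible p ∧ aeval t p ∈ S ∧
      (hσ.zpow l).poly q = p := by
  obtain ⟨p, ⟨hpS, c, hc, -, l, hpl⟩, -⟩ := hS.2 (aeval t q) ⟨q, hm, hq, rfl⟩
  obtain ⟨p, hpm, hp, rfl⟩ := hS.1 hpS
  refine ⟨p, l, hpm, hp, hpS, ?_⟩
  rw [← (hσ.zpow l).aeval_poly] at hpl
  have h : p = C ⟨c, hc⟩ * (hσ.zpow l).poly q :=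
    aeval_injective_of_transcendental ht (by rw [hpl, map_mul, aeval_C]; rfl)
  -- Both polynomials are monic, so the scalar allowed by the equivalence is 1.
  have hlead : (1 : K) = ⟨c, hc⟩ := by
    have := congrArg leadingCoeff h
    rwa [leadingCoeff_mul, leadingCoeff_C, hpm, ((hσ.zpow l).monic_poly hm), mul_one] at this
  rw [h, ← hlead, C_1, one_mul]

/-- The elements of `U_S` are regular at all proper shifts of the elements of `S`. -/
theorem regularAt_of_mem_properComplement [CharZero E] (ht : Transcendental K t)
    (hC : ∀ x, σ x = x → x ∈ K) (hσ : IsShift K t σ) {S : Set E}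
    (hS : IsRepresentativeSet σ K t S) {p : K[X]} (hm : p.Monic) (hp : Irreducible p)
    (hpS : aeval t p ∈ S) {j : ℤ} (hj : j ≠ 0) {u : E} (hu : u ∈ properComplement K t S) :
    RegularAt K t ((hσ.zpow j).poly p) u := by
  obtain ⟨-, a, d, hd, rfl⟩ := hu
  have hirr := (hσ.zpow j).irreducible_poly hp
  suffices ∃ e : K[X], ¬ (hσ.zpow j).poly p ∣ e ∧ d = aeval t e by
    obtain ⟨e, he, rfl⟩ := this
    exact ⟨a, e, he, rfl⟩
  induction hd using Submonoid.closure_induction with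
  | mem d hd =>
    obtain ⟨q, hqm, hq, rfl⟩ := hS.1 hd
    refine ⟨q, fun hdvd => hj ?_, rfl⟩
    have hpq : (hσ.zpow j).poly p = q := eq_of_monic_of_associated
      ((hσ.zpow j).monic_poly hm) hqm (hirr.associated_of_dvd hq hdvd)
    have hq' : aeval t q = (σ ^ j) (aeval t p) := by rw [← hpq, (hσ.zpow j).aeval_poly]
    -- Both p and its j-th shift would represent the class of p, so they coincide and j = 0.
    obtain ⟨x, -, hx⟩ := hS.2 (aeval t p) ⟨p, hm, hp, rfl⟩
    have h1 := hx (aeval t p) ⟨hpS, 1, K.one_mem, one_ne_zero, 0, by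
      rw [zpow_zero, RingAut.one_apply, one_mul]⟩
    have h2 := hx (aeval t q) ⟨hd, 1, K.one_mem, one_ne_zero, j, by rw [hq', one_mul]⟩
    exact eq_zero_of_zpow_fixed ht hC hσ hm hp (hq'.symm.trans (h2.trans h1.symm))
  | one => exact ⟨1, fun h => hirr.not_isUnit (isUnit_of_dvd_one h), by simp⟩
  | mul x y _ _ hx hy =>
    obtain ⟨e, he, rfl⟩ := hx
    obtain ⟨e', he', rfl⟩ := hy
    exact ⟨e * e', fun h => (hirr.prime.dvd_or_dvd h).elim he he', (map_mul _ _ _).symm⟩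

theorem IsShift.poly_zpow_add (ht : Transcendental K t) (hσ : IsShift K t σ) (i j : ℤ)
    (p : K[X]) :
    (hσ.zpow i).poly ((hσ.zpow j).poly p) = (hσ.zpow (i + j)).poly p := by
  apply aeval_injective_of_transcendental ht
  rw [(hσ.zpow i).aeval_poly, (hσ.zpow j).aeval_poly, (hσ.zpow (i + j)).aeval_poly, zpow_add,
    RingAut.mul_apply]

theorem regularAt_zpow_iff (ht : Transcendental K t) (hσ : IsShift K t σ) (i j : ℤ) {p : K[X]}
    {f : E} : RegularAt K t ((hσ.zpow (i + j)).poly p) ((σ ^ i) f) ↔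
      RegularAt K t ((hσ.zpow j).poly p) f := by
  constructor
  · intro h
    have h' := (hσ.zpow (-i)).regularAt h
    rw [hσ.poly_zpow_add ht, neg_add_cancel_left, ← RingAut.mul_apply, ← zpow_add,
      neg_add_cancel, zpow_zero, RingAut.one_apply] at h'
    exact h'
  · intro h
    have h' := (hσ.zpow i).regularAt h
    rwa [hσ.poly_zpow_add ht] at h'

/-- Each such shift is a monic irreducible factor of a denominator, and different j give different
factors because the orbit of p is infinite. -/
theorem finite_not_regularAt_zpow [CharZero E] (ht : Transcendental K t) (hC : ∀ x, σ x = x → x ∈ K)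
    (hσ : IsShift K t σ) {p : K[X]} (hm : p.Monic) (hp : Irreducible p) {f : E}
    (hf : IsFraction K t f) : {j : ℤ | ¬ RegularAt K t ((hσ.zpow j).poly p) f}.Finite := by
  classical
  obtain ⟨a, d, hd, rfl⟩ := hf
  refine Set.Finite.of_injOn (f := fun j : ℤ => (hσ.zpow j).poly p)
    (t := ((UniqueFactorizationMonoid.normalizedFactors d).toFinset : Set K[X])) ?_ ?_
    (Finset.finite_toSet _)
  · intro j hj
    rw [Finset.mem_coe, Multiset.mem_toFinset,
      UniqueFactorizationMonoid.mem_normalizedFactors_iff' hd]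
    refine ⟨(hσ.zpow j).irreducible_poly hp, ((hσ.zpow j).monic_poly hm).normalize_eq_self, ?_⟩
    by_contra h
    exact hj ⟨a, d, h, rfl⟩
  · intro i _ j _ hij
    have h := congrArg (hσ.zpow (-j)).poly hij
    simp only [hσ.poly_zpow_add ht] at h
    have h' := congrArg (aeval t) h
    rw [(hσ.zpow _).aeval_poly, (hσ.zpow _).aeval_poly, neg_add_cancel, zpow_zero,
      RingAut.one_apply] at h'
    have := eq_zero_of_zpow_fixed ht hC hσ hm hp h'
    omega

/-- No nonzero proper fraction has its difference in `U_S`. -/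
theorem eq_zero_of_delta_mem_properComplement [CharZero E] (ht : Transcendental K t)
    (hC : ∀ x, σ x = x → x ∈ K) (hσ : IsShift K t σ) {S : Set E}
    (hS : IsRepresentativeSet σ K t S) {g : E} (hg : IsProper K t g)
    (hu : σ g - g ∈ properComplement K t S) : g = 0 := by
  by_contra hg0
  have hpole : ∃ q : K[X], q.Monic ∧ Irreducible q ∧ ¬ RegularAt K t q g := by
    by_contra! h
    obtain ⟨p, rfl⟩ := hg.isFraction.exists_eq_aeval ht h
    exact hg0 (by rw [eq_zero_of_isProper_aeval ht hg, map_zero])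
  obtain ⟨q, hqm, hq, hqg⟩ := hpole
  obtain ⟨p, l, hm, hp, hpS, hpl⟩ := exists_zpow_eq_of_mem_monicIrreducibles ht hσ hS hqm hq
  have hfin := finite_not_regularAt_zpow ht hC hσ hm hp hg.isFraction
  have hne : {j : ℤ | ¬ RegularAt K t ((hσ.zpow j).poly p) g}.Nonempty := by
    refine ⟨-l, ?_⟩
    have hq' : (hσ.zpow (-l)).poly p = q := by
      apply aeval_injective_of_transcendental ht
      rw [← hpl, hσ.poly_zpow_add ht, (hσ.zpow _).aeval_poly, neg_add_cancel, zpow_zero,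
        RingAut.one_apply]
    rwa [Set.mem_ofPred_eq, hq']
  have hshift : ∀ j : ℤ, RegularAt K t ((hσ.zpow (1 + j)).poly p) (σ g) ↔
      RegularAt K t ((hσ.zpow j).poly p) g := by
    intro j
    have := regularAt_zpow_iff ht hσ 1 j (p := p) (f := g)
    rwa [zpow_one] at this
  have hreg : ∀ j : ℤ, j ≠ 0 → RegularAt K t ((hσ.zpow j).poly p) (σ g - g) := fun j hj =>
    regularAt_of_mem_properComplement ht hC hσ hS hm hp hpS hj hu
  have hirr : ∀ j : ℤ, Irreducible ((hσ.zpow j).poly p) := fun j =>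
    (hσ.zpow j).irreducible_poly hp
  -- Let b and a be the last and first poles of g on the orbit. At 1 + b only σ g has a pole, and at
  -- a only g does, so Δ(g) has poles at both. Membership in U_S permits a pole only at 0, forcing b
  -- = -1 and a = 0, against a ≤ b.
  obtain ⟨b, hb, hbmax⟩ := Set.exists_max_image _ id hfin hne
  obtain ⟨a, ha, hamin⟩ := Set.exists_min_image _ id hfin hne
  simp only [Set.mem_ofPred_eq, id] at hb hbmax ha hamin
  have hb0 : 1 + b = 0 := by
    by_contra h0
    have h1 : RegularAt K t ((hσ.zpow (1 + b)).poly p) g := by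
      by_contra h
      have := hbmax _ h
      omega
    have h2 := (hreg _ h0).add ht (hirr _) h1
    rw [sub_add_cancel, hshift] at h2
    exact hb h2
  have ha0 : a = 0 := by
    by_contra h0
    have h1 : RegularAt K t ((hσ.zpow (-1 + a)).poly p) g := by
      by_contra h
      have := hamin _ h
      omega
    rw [← hshift, add_neg_cancel_left] at h1
    have h2 := h1.sub ht (hirr _) (hreg _ h0)
    rw [sub_sub_cancel] at h2
    exact ha h2
  have := hamin b hb
  omega

/-- Telescoping: g is a sum of intermediate shifts of x, with sign for negative l. -/
theorem exists_delta_zpow {L : IntermediateField k E} (hL : ∀ x, σ x ∈ L ↔ x ∈ L) {x : E}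
    (hx : x ∈ L) (l : ℤ) : ∃ g ∈ L, (σ ^ l) x - x = σ g - g := by
  have hmem : ∀ l : ℤ, (σ ^ l) x ∈ L := by
    intro l
    -- The generator 0 is a dummy that makes the stability of L under powers of σ available.
    have hsh : IsShift L 0 σ := ⟨hL, by simp⟩
    exact ((hsh.zpow l).1 x).2 hx
  have hstep : ∀ l : ℤ, (σ ^ (l + 1)) x = σ ((σ ^ l) x) := fun l => by
    rw [add_comm, zpow_one_add, RingAut.mul_apply]
  induction l using Int.induction_on with
  | zero => exact ⟨0, L.zero_mem, by simp⟩
  | succ i ih =>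
    obtain ⟨g, hg, h⟩ := ih
    refine ⟨g + (σ ^ (i : ℤ)) x, L.add_mem hg (hmem _), ?_⟩
    rw [hstep, map_add]
    linear_combination h
  | pred i ih =>
    obtain ⟨g, hg, h⟩ := ih
    refine ⟨g - (σ ^ (-(i : ℤ) - 1)) x, L.sub_mem hg (hmem _), ?_⟩
    have h1 := hstep (-(i : ℤ) - 1)
    rw [sub_add_cancel] at h1
    rw [map_sub, ← h1]
    linear_combination h

/-- A suitable power of σ carries q to its representative in S; the shifted fraction lies in U_S and
differs from the original by a difference. -/
theorem exists_delta_add_mem_properComplement (ht : Transcendental K t) (hσ : IsShift K t σ)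
    {L : IntermediateField k E} (hL : ∀ x, σ x ∈ L ↔ x ∈ L)
    (hLK : ∀ f, IsFraction K t f → f ∈ L) {S : Set E} (hS : IsRepresentativeSet σ K t S)
    {r q : K[X]} (j : ℕ) (hm : q.Monic) (hq : Irreducible q) (hr : r.degree < q.degree) :
    ∃ g ∈ L, ∃ u ∈ properComplement K t S,
      aeval t r / aeval t q ^ (j + 1) = σ g - g + u := by
  obtain ⟨p, l, hpm, hp, hpS, hpl⟩ := exists_zpow_eq_of_mem_monicIrreducibles ht hσ hS hm hq
  have hx : IsProper K t (aeval t r / aeval t q ^ (j + 1)) := by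
    refine ⟨r, q ^ (j + 1), hr.trans_le ?_, by rw [map_pow]⟩
    rw [degree_eq_natDegree hq.ne_zero, degree_eq_natDegree (pow_ne_zero _ hq.ne_zero),
      natDegree_pow]
    exact_mod_cast Nat.le_mul_of_pos_left _ (Nat.succ_pos j)
  obtain ⟨g, hg, h⟩ := exists_delta_zpow hL (hLK _ hx.isFraction) l
  refine ⟨-g, L.neg_mem hg, (σ ^ l) (aeval t r / aeval t q ^ (j + 1)),
    ⟨(hσ.zpow l).isProper hx, (hσ.zpow l).poly r, aeval t p ^ (j + 1),
      Submonoid.pow_mem _ (Submonoid.subset_closure hpS) _, ?_⟩, ?_⟩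
  · rw [map_div₀, map_pow, ← (hσ.zpow l).aeval_poly, ← (hσ.zpow l).aeval_poly, hpl]
  · rw [map_neg]
    linear_combination -h

end Decomposition

end SigmaReduction

namespace SigmaReduction

/-! ### Direct decomposition for one extension K(t). -/

section Step

variable {E : Type*} [Field E] {σ : E ≃+* E}
  {K L : IntermediateField (constField σ) E} {t : E}

theorem constField_mem (K : IntermediateField (constField σ) E) {x : E} (hx : σ x = x) : x ∈ K :=
  K.algebraMap_mem ⟨x, hx⟩

/-- Polynomials can be reduced modulo differences to polynomials with coefficients in a complement
`W` of `Δ(K) + C Δ(t)`. -/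
theorem monomial_mem_of_delta_mem [CharZero E] (hσ : IsShift K t σ)
    {W : Submodule (constField σ) K}
    (hW : ∀ a : K, ∃ b : K, ∃ c : constField σ, ∃ w ∈ W,
      (a : E) = σ b - b + c * (σ t - t) + w)
    (N : AddSubgroup E) (hΔ : ∀ p : K[X], σ (aeval t p) - aeval t p ∈ N)
    (hN : ∀ w ∈ W, ∀ i : ℕ, (w : E) * t ^ i ∈ N) (a : K) (i : ℕ) : (a : E) * t ^ i ∈ N := by
  induction i using Nat.strong_induction_on generalizing a with
  | _ i ih =>
    have hlow : ∀ p : K[X], (∀ j, i ≤ j → p.coeff j = 0) → aeval t p ∈ N := by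
      intro p hp
      rw [aeval_def, eval₂_eq_sum]
      refine N.sum_mem fun j hj => ih j ?_ _
      by_contra h
      exact mem_support_iff.1 hj (hp j (not_lt.1 h))
    obtain ⟨b, c, w, hw, ha⟩ := hW a
    have hc : σ (c : E) = c := c.2
    have hi : ((i : E) + 1) ≠ 0 := by exact_mod_cast Nat.succ_ne_zero i
    let c' : K := algebraMap (constField σ) K c / (i + 1)
    have hc' : ((c' : K) : E) = c / (i + 1) := by
      simp only [c']
      push_cast
      rfl
    -- Since c' is a constant, Δ(P) has no t^(i+1)-term; the factor 1/(i+1) makes its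
    -- t^i-coefficient Δ(b) + c Δ(t). Only lower degrees remain after subtracting Δ(P) and w t^i.
    let P : K[X] := C b * X ^ i + C c' * X ^ (i + 1)
    have hP : P.natDegree ≤ i + 1 :=
      (natDegree_add_le _ _).trans (max_le ((natDegree_C_mul_X_pow_le _ _).trans (Nat.le_succ i))
        (natDegree_C_mul_X_pow_le _ _))
    have hPi : P.coeff i = b := by simp [P, coeff_X_pow]
    have hPi1 : P.coeff (i + 1) = c' := by simp [P, coeff_X_pow]
    have hR := hlow (C a * X ^ i - (hσ.poly P - P) - C w * X ^ i) (by
      intro j hj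
      rw [coeff_sub, coeff_sub, coeff_sub, coeff_C_mul_X_pow, coeff_C_mul_X_pow]
      rcases hj.lt_or_eq with hlt | rfl
      · rw [if_neg hlt.ne', if_neg hlt.ne', sub_zero, zero_sub, neg_eq_zero]
        rcases (Nat.succ_le_of_lt hlt).lt_or_eq with hlt' | rfl
        · rw [coeff_eq_zero_of_natDegree_lt (p := P) (by omega),
            coeff_eq_zero_of_natDegree_lt (by rw [hσ.natDegree_poly]; omega), sub_zero]
        · apply Subtype.ext
          push_cast
          rw [hσ.coeff_poly_of_natDegree_le hP, Nat.succ_eq_add_one, hPi1, hc', map_div₀, hc]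
          simp
      · rw [if_pos rfl, if_pos rfl]
        apply Subtype.ext
        push_cast
        rw [hσ.coeff_poly hP, hPi, hPi1, hc', ha, map_div₀, hc]
        simp only [map_add, map_natCast, map_one]
        field_simp
        ring)
    have hsum : (a : E) * t ^ i = aeval t (C a * X ^ i - (hσ.poly P - P) - C w * X ^ i)
        + (σ (aeval t P) - aeval t P) + w * t ^ i := by
      simp only [map_sub, hσ.aeval_poly, map_mul, aeval_C, map_pow, aeval_X]
      change _ = (a : E) * t ^ i - _ - (w : E) * t ^ i + _ + _
      ring
    rw [hsum]
    exact N.add_mem (N.add_mem hR (hΔ P)) (hN w hw i)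

/-- The only polynomial difference with coefficients in a complement of `Δ(K) ⊕ C Δ(t)` is `0`. -/
theorem delta_eq_zero_of_coeff_mem [CharZero E] (hσ : IsShift K t σ)
    {W : Submodule (constField σ) K}
    (hW : ∀ (b : K) (c : constField σ), ∀ w ∈ W, σ b - b + c * (σ t - t) = w → c = 0 ∧ σ b = b)
    {P : K[X]} (hP : ∀ i, (hσ.poly P - P).coeff i ∈ W) : σ (aeval t P) = aeval t P := by
  -- The coefficient of Δ(P) in degree deg P is the difference of the leading coefficient; it lies
  -- in W, hence vanishes.
  have htop : σ (P.coeff P.natDegree) = P.coeff P.natDegree := by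
    refine (hW _ 0 _ (hP P.natDegree) ?_).2
    rw [coeff_sub]
    push_cast
    rw [hσ.coeff_poly_of_natDegree_le le_rfl]
    ring
  rcases Nat.eq_zero_or_eq_succ_pred P.natDegree with h0 | h0
  · rw [h0] at htop
    rw [eq_C_of_natDegree_eq_zero h0, aeval_C]
    exact htop
  · exfalso
    generalize P.natDegree.pred = d at h0
    rw [h0] at htop
    -- Now the leading coefficient is a constant, and the next coefficient of Δ(P) has the form Δ(b)
    -- + c Δ(t) with c = (d+1) times it. Directness gives c = 0, impossible in characteristic zero.
    have h := (hW (P.coeff d) ⟨(d + 1) * P.coeff (d + 1), by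
      change σ _ = _
      rw [map_mul, htop]
      simp⟩ _ (hP d) (by
        rw [coeff_sub]
        push_cast
        rw [hσ.coeff_poly h0.le, htop]
        ring)).1
    have h' : ((d : E) + 1) * P.coeff (d + 1) = 0 := congrArg Subtype.val h
    have hd : ((d : E) + 1) ≠ 0 := by exact_mod_cast Nat.succ_ne_zero d
    have hlead : P.coeff (d + 1) = 0 := by
      apply Subtype.ext
      simpa [hd] using h'
    have hP0 : P ≠ 0 := by
      rintro rfl
      simp at h0
    rw [← Nat.succ_eq_add_one, ← h0] at hlead
    exact hP0 (leadingCoeff_eq_zero.1 hlead)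

/-- A projection onto a complement of `Δ(K)` yields a complement of `Δ(K) ⊕ C Δ(t)`. -/
theorem exists_delta_add_of_isCompleteReduction {φ : K →ₗ[constField σ] K}
    (hφ : ∀ f : K, ∃ g : K, (f : E) - φ f = σ g - g) (d : K)
    {ev : E →ₗ[constField σ] constField σ} (hev : ev (φ d : E) ≠ 0) (a : K) :
    ∃ b : K, ∃ c : constField σ,
      ∃ w ∈ LinearMap.range φ ⊓ LinearMap.ker (ev ∘ₗ K.val.toLinearMap),
        (a : E) = σ b - b + c * d + w := by
  -- Chosen so that `ev` vanishes on φ(a - c d).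
  let c : constField σ := ev (φ a : E) / ev (φ d : E)
  have hc : σ (c : E) = c := c.2
  obtain ⟨g, hg⟩ := hφ a
  obtain ⟨h, hh⟩ := hφ d
  refine ⟨g - c • h, c, φ (a - c • d), ⟨LinearMap.mem_range_self φ _, ?_⟩, ?_⟩
  · rw [SetLike.mem_coe, LinearMap.mem_ker, map_sub, map_smul, map_sub, map_smul]
    change ev (φ a : E) - c * ev (φ d : E) = 0
    rw [div_mul_cancel₀ _ hev, sub_self]
  · rw [map_sub, map_smul]
    push_cast
    simp only [Subfield.smul_def, smul_eq_mul]
    rw [map_sub, map_mul, hc]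
    linear_combination hg - (c : E) * hh

/-- Applying φ kills Δ(b) and fixes w, so w = c φ(d). As `ev` kills w but not φ(d), c = 0, and then
Δ(b) = 0. -/
theorem eq_zero_of_delta_add_mem {φ : K →ₗ[constField σ] K}
    (hφ : ∀ f : K, ∃ g : K, (f : E) - φ f = σ g - g)
    (hφ' : ∀ f : K, φ f = 0 ↔ ∃ g : K, (f : E) = σ g - g) (d : K)
    {ev : E →ₗ[constField σ] constField σ} (hev : ev (φ d : E) ≠ 0)
    (b : K) (c : constField σ) (w : K)
    (hw : w ∈ LinearMap.range φ ⊓ LinearMap.ker (ev ∘ₗ K.val.toLinearMap))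
    (h : σ b - b + c * d = (w : E)) : c = 0 ∧ σ b = b := by
  obtain ⟨⟨f, rfl⟩, hker⟩ := hw
  rw [SetLike.mem_coe, LinearMap.mem_ker] at hker
  have hidem : φ (φ f) = φ f := by
    have : φ (f - φ f) = 0 := (hφ' _).2 (by simpa using hφ f)
    rw [map_sub, sub_eq_zero] at this
    exact this.symm
  have hfd : φ (φ f - c • d) = 0 := (hφ' _).2 ⟨b, by
    push_cast
    simp only [Subfield.smul_def, smul_eq_mul]
    linear_combination -h⟩
  rw [map_sub, hidem, map_smul, sub_eq_zero] at hfd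
  have hc : c = 0 := by
    have h1 : ev (φ f : E) = 0 := hker
    have h2 : ev (φ f : E) = c * ev (φ d : E) := by
      rw [hfd]
      exact map_smul ev c (φ d : E)
    exact (mul_eq_zero.1 (h2.symm.trans h1)).resolve_right hev
  refine ⟨hc, ?_⟩
  rw [hfd, hc] at h
  simpa [sub_eq_zero] using h

/-- The differences of elements of `L`, as a subspace of `E`. -/
def deltaSubmodule (σ : E ≃+* E) (L : IntermediateField (constField σ) E) :
    Submodule (constField σ) E where
  carrier := {f | ∃ g ∈ L, f = σ g - g}
  zero_mem' := ⟨0, L.zero_mem, by simp⟩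
  add_mem' := by
    rintro f f' ⟨g, hg, rfl⟩ ⟨g', hg', rfl⟩
    refine ⟨g + g', L.add_mem hg hg', ?_⟩
    rw [map_add]
    ring
  smul_mem' := by
    rintro c f ⟨g, hg, rfl⟩
    have hc : σ (c : E) = c := c.2
    refine ⟨c • g, L.smul_mem hg, ?_⟩
    simp only [Subfield.smul_def, smul_eq_mul]
    rw [map_mul, hc]
    ring

variable [CharZero E] {W : Submodule (constField σ) K} {S : Set E}

/-- `L = Δ(L) + U_S + V_W` for `L = K(t)`. -/
theorem exists_delta_decomposition (ht : Transcendental K t) (hσ : IsShift K t σ)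
    (hL : ∀ x, σ x ∈ L ↔ x ∈ L) (hLK : ∀ f, f ∈ L ↔ IsFraction K t f)
    (hS : IsRepresentativeSet σ K t S)
    (hW : ∀ a : K, ∃ b : K, ∃ c : constField σ, ∃ w ∈ W,
      (a : E) = σ b - b + c * (σ t - t) + w)
    {f : E} (hf : f ∈ L) :
    ∃ g ∈ L, ∃ u ∈ properComplement K t S, ∃ v ∈ polySubmodule t W, f = σ g - g + u + v := by
  let U := properComplementSubmodule ht hS.1
  let V := polySubmodule t W
  have key : f ∈ deltaSubmodule σ L ⊔ U ⊔ V := by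
    have hΔ : deltaSubmodule σ L ≤ deltaSubmodule σ L ⊔ U ⊔ V := le_sup_left.trans le_sup_left
    refine ((hLK f).1 hf).mem_of_partial_fractions ht
      (deltaSubmodule σ L ⊔ U ⊔ V).toAddSubgroup ?_ ?_
    · refine monomial_mem_of_delta_mem hσ hW _ (fun p => hΔ ⟨_, (hLK _).2 (isFraction_aeval p), rfl⟩)
        (fun w hw i => le_sup_right (a := deltaSubmodule σ L ⊔ U) ⟨C w * X ^ i, fun j => ?_, ?_⟩)
      · rw [coeff_C_mul_X_pow]
        split_ifs
        exacts [hw, W.zero_mem]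
      · rw [map_mul, aeval_C, map_pow, aeval_X]
        rfl
    · intro r q j hm hq hr
      obtain ⟨g, hg, u, hu, h⟩ := exists_delta_add_mem_properComplement ht hσ hL
        (fun f => (hLK f).2) hS j hm hq hr
      rw [h]
      exact Submodule.add_mem _ (hΔ ⟨g, hg, rfl⟩)
        ((le_sup_right.trans le_sup_left : U ≤ deltaSubmodule σ L ⊔ U ⊔ V) hu)
  obtain ⟨x, hx, v, hv, rfl⟩ := Submodule.mem_sup.1 key
  obtain ⟨_, ⟨g, hg, rfl⟩, u, hu, rfl⟩ := Submodule.mem_sup.1 hx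
  exact ⟨g, hg, u, hu, v, hv, rfl⟩

/-- The sum `Δ(L) + U_S + V_W` is direct for `L = K(t)`. -/
theorem delta_decomposition_unique (ht : Transcendental K t) (hσ : IsShift K t σ)
    (hS : IsRepresentativeSet σ K t S)
    (hW : ∀ (b : K) (c : constField σ), ∀ w ∈ W, σ b - b + c * (σ t - t) = w → c = 0 ∧ σ b = b)
    {g u v : E} (hg : IsFraction K t g) (hu : u ∈ properComplement K t S)
    (hv : v ∈ polySubmodule t W) (h : σ g - g = u + v) : σ g = g ∧ u = 0 ∧ v = 0 := by
  obtain ⟨P, x, hx, rfl⟩ := hg.exists_add_isProper ht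
  obtain ⟨Q, hQ, rfl⟩ := hv
  -- A polynomial equals a proper fraction here, so both sides vanish and the two parts can be
  -- treated separately.
  have hpoly : aeval t (hσ.poly P - P - Q) = u - (σ x - x) := by
    rw [map_sub, map_sub, hσ.aeval_poly]
    rw [map_add] at h
    linear_combination h
  have hprop : IsProper K t (aeval t (hσ.poly P - P - Q)) := by
    rw [hpoly]
    exact (properSubmodule ht).sub_mem hu.1 ((properSubmodule ht).sub_mem (hσ.isProper hx) hx)
  have h0 := eq_zero_of_isProper_aeval ht hprop
  rw [h0, map_zero] at hpoly
  have hu' : u = σ x - x := sub_eq_zero.1 hpoly.symm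
  have hx0 : x = 0 := eq_zero_of_delta_mem_properComplement ht (fun _ => constField_mem K) hσ hS hx
    (hu' ▸ hu)
  have hP : σ (aeval t P) = aeval t P := by
    refine delta_eq_zero_of_coeff_mem hσ hW (P := P) fun i => ?_
    rw [sub_eq_zero.1 h0]
    exact hQ i
  subst hx0
  rw [map_zero, sub_zero] at hu'
  refine ⟨by rw [map_add, hP, map_zero], hu', ?_⟩
  rw [← sub_eq_zero.1 h0, map_sub, hσ.aeval_poly, hP, sub_self]

end Step

end SigmaReduction

/-! ### Complete reductions on consecutive levels of the tower. -/

namespace SigmaReduction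

theorem exists_isCompleteReduction_of_isCompl {C V : Type*} [Field C] [AddCommGroup V] [Module C V]
    {U R : Submodule C V} (h : IsCompl R U) :
    ∃ ψ : V →ₗ[C] V, IsCompleteReduction U ψ ∧ LinearMap.range ψ = R := by
  have hker : ∀ x, R.projection U h x = 0 ↔ x ∈ U := fun x =>
    Submodule.projection_apply_eq_zero_iff h
  refine ⟨R.projection U h, ⟨fun f => ?_, ?_⟩, Submodule.range_projection h⟩
  · rw [← hker, map_sub, Submodule.projection_apply_of_mem_left h
      (Submodule.projection_apply_mem h f), sub_self]
  · ext x
    exact hker x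

namespace SigmaTower

variable {E : Type*} [Field E] {σ : E ≃+* E} {n : ℕ} (T : SigmaTower σ n)

theorem mem_succ_iff (i : Fin n) (f : E) :
    f ∈ T.F i.succ ↔ IsFraction (T.F i.castSucc) (T.t i) f := by
  rw [T.adjoin_eq i]
  exact mem_adjoin_insert_iff_isFraction

theorem le_succ (i : Fin n) : T.F i.castSucc ≤ T.F i.succ := fun x hx =>
  (T.mem_succ_iff i x).2 ⟨C ⟨x, hx⟩, 1, one_ne_zero, by rw [aeval_C, map_one, div_one]; rfl⟩

theorem F_monotone : Monotone T.F := Fin.monotone_iff_le_succ.2 T.le_succ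

/-- Stability is assumed only at the bottom; it climbs because σ and its inverse both map fractions
in t to fractions in t. -/
theorem stable (i : Fin (n + 1)) (x : E) : σ x ∈ T.F i ↔ x ∈ T.F i := by
  induction i using Fin.induction generalizing x with
  | zero => exact T.base_stable x
  | succ i ih =>
    have h : IsShift (T.F i.castSucc) (T.t i) σ := ⟨ih, T.delta_mem i⟩
    rw [T.mem_succ_iff, T.mem_succ_iff]
    refine ⟨fun hx => ?_, h.isFraction⟩
    have h' := h.inv.isFraction hx
    rwa [show σ⁻¹ (σ x) = x from σ.symm_apply_apply x] at h'

theorem isShift (i : Fin n) : IsShift (T.F i.castSucc) (T.t i) σ :=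
  ⟨T.stable i.castSucc, T.delta_mem i⟩

theorem isCompleteReduction_iff {i : Fin (n + 1)}
    {φ : T.F i →ₗ[constField σ] T.F i} :
    IsCompleteReduction (T.summable i) φ ↔
      (∀ f : T.F i, ∃ g : T.F i, (f : E) - φ f = σ g - g) ∧
        ∀ f : T.F i, φ f = 0 ↔ ∃ g : T.F i, (f : E) = σ g - g :=
  and_congr Iff.rfl SetLike.ext_iff

/-- Otherwise Δ(t) = Δ(g) with g in the lower field. Then t - g is a constant, constants lie in that
field, and so would t. -/
theorem apply_deltaGen_ne_zero (i : Fin n) {φ : T.F i.castSucc →ₗ[constField σ] T.F i.castSucc}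
    (hφ : IsCompleteReduction (T.summable i.castSucc) φ) : φ (T.deltaGen i) ≠ 0 := by
  intro h
  obtain ⟨g, hg⟩ := ((T.isCompleteReduction_iff.1 hφ).2 _).1 h
  have hg' : σ (T.t i) - T.t i = σ g - g := hg
  have hc : σ (T.t i - g) = T.t i - g := by
    rw [map_sub]
    linear_combination hg'
  refine not_mem_of_transcendental (T.transcendental i) ?_
  simpa using (T.F i.castSucc).add_mem (constField_mem _ hc) g.2

theorem exists_next_reduction [CharZero E] (i : Fin n) {S : Set E}
    (hS : IsRepresentativeSet σ (T.F i.castSucc) (T.t i) S)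
    {φ : T.F i.castSucc →ₗ[constField σ] T.F i.castSucc}
    (hφ : IsCompleteReduction (T.summable i.castSucc) φ)
    {ev : E →ₗ[constField σ] constField σ} (hev : ev (φ (T.deltaGen i) : E) ≠ 0) :
    ∃ ψ : T.F i.succ →ₗ[constField σ] T.F i.succ,
      IsCompleteReduction (T.summable i.succ) ψ ∧ T.EstablishesDecomposition i S φ ev ψ := by
  have ht := T.transcendental i
  have hσ := T.isShift i
  obtain ⟨hφ₁, hφ₂⟩ := T.isCompleteReduction_iff.1 hφ
  let W := LinearMap.range φ ⊓ LinearMap.ker (ev ∘ₗ (T.F i.castSucc).val.toLinearMap)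
  let U := properComplementSubmodule ht hS.1
  let V := polySubmodule (T.t i) W
  have hex : ∀ f ∈ T.F i.succ, ∃ g ∈ T.F i.succ, ∃ u ∈ U, ∃ v ∈ V, f = σ g - g + u + v :=
    fun f hf => exists_delta_decomposition ht hσ (T.stable i.succ) (T.mem_succ_iff i) hS
      (exists_delta_add_of_isCompleteReduction hφ₁ (T.deltaGen i) hev) hf
  have huniq : ∀ g ∈ T.F i.succ, ∀ u ∈ U, ∀ v ∈ V, σ g - g = u + v →
      σ g = g ∧ u = 0 ∧ v = 0 := fun g hg u hu v hv h =>
    delta_decomposition_unique ht hσ hS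
      (eq_zero_of_delta_add_mem hφ₁ hφ₂ (T.deltaGen i) hev) ((T.mem_succ_iff i g).1 hg) hu hv h
  have hU : ∀ u ∈ U, u ∈ T.F i.succ := fun u hu => (T.mem_succ_iff i u).2 hu.1.isFraction
  have hV : ∀ v ∈ V, v ∈ T.F i.succ := by
    rintro v ⟨p, -, rfl⟩
    exact (T.mem_succ_iff i _).2 (isFraction_aeval p)
  let R : Submodule (constField σ) (T.F i.succ) :=
    (U ⊔ V).comap (T.F i.succ).val.toLinearMap
  have hR : ∀ h : T.F i.succ, h ∈ R ↔ ∃ u ∈ U, ∃ v ∈ V, (h : E) = u + v := by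
    intro h
    refine Submodule.mem_sup.trans ?_
    constructor
    · rintro ⟨u, hu, v, hv, e⟩
      exact ⟨u, hu, v, hv, e.symm⟩
    · rintro ⟨u, hu, v, hv, e⟩
      exact ⟨u, hu, v, hv, e.symm⟩
  have hcompl : IsCompl R (T.summable i.succ) := by
    refine ⟨Submodule.disjoint_def.2 ?_, codisjoint_iff.2 (eq_top_iff.2 ?_)⟩
    · rintro x hx ⟨g, hg⟩
      obtain ⟨u, hu, v, hv, e⟩ := (hR x).1 hx
      obtain ⟨h1, -, -⟩ := huniq g g.2 u hu v hv (hg.symm.trans e)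
      apply Subtype.ext
      rw [hg, h1, sub_self]
      rfl
    · rintro ⟨f, hf⟩ -
      obtain ⟨g, hg, u, hu, v, hv, e⟩ := hex f hf
      refine Submodule.mem_sup.2 ⟨⟨u + v, (T.F i.succ).add_mem (hU u hu) (hV v hv)⟩,
        (hR _).2 ⟨u, hu, v, hv, rfl⟩,
        ⟨σ g - g, (T.F i.succ).sub_mem ((T.stable _ _).2 hg) hg⟩, ⟨⟨g, hg⟩, rfl⟩, ?_⟩
      apply Subtype.ext
      push_cast
      rw [e]
      ring
  obtain ⟨ψ, hψ, hrange⟩ := exists_isCompleteReduction_of_isCompl hcompl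
  refine ⟨ψ, hψ, fun f hf => ?_, fun h => ?_⟩
  · obtain ⟨g, hg, u, hu, v, hv, e⟩ := hex f hf
    refine ⟨(σ g - g, u, v), ⟨⟨g, hg, rfl⟩, hu, hv, e⟩, ?_⟩
    rintro ⟨_, u', v'⟩ ⟨⟨g', hg', rfl⟩, hu', hv', e'⟩
    have hv'' : v' ∈ V := hv'
    dsimp only at hu' e'
    -- Subtracting two decompositions reduces to zero; g is determined only up to a constant, but
    -- Δ(g) is unique.
    obtain ⟨h1, h2, h3⟩ := huniq (g - g') ((T.F i.succ).sub_mem hg hg') (u' - u)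
      (U.sub_mem hu' hu) (v' - v) (V.sub_mem hv'' hv) (by
        rw [map_sub]
        linear_combination e' - e)
    rw [sub_eq_zero] at h2 h3
    rw [map_sub] at h1
    rw [h2, h3]
    congr 1
    linear_combination -h1
  · rw [hrange]
    exact hR h

/-! ### The canonical basis of the tower and indicators. -/

/-- The products of an element of `Θ₀` and elements of the canonical bases of the first `i`
extensions. -/
def partialBasis (Θ₀ : Set (T.F 0)) (i : Fin (n + 1)) : Set E :=
  {ξ | ∃ θ₀ ∈ Θ₀, ∃ θ : Fin n → E, (∀ j, θ j ∈ stepBasis (T.F j.castSucc) (T.t j)) ∧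
    (∀ j, i ≤ j.castSucc → θ j = 1) ∧ ξ = (θ₀ : E) * ∏ j, θ j}

variable (Θ₀ : Set (T.F 0))

theorem one_mem_stepBasis (j : Fin n) : (1 : E) ∈ stepBasis (T.F j.castSucc) (T.t j) :=
  Or.inl ⟨0, (pow_zero _).symm⟩

theorem partialBasis_last : T.partialBasis Θ₀ (Fin.last n) = T.canonicalBasis Θ₀ := by
  ext ξ
  constructor
  · rintro ⟨θ₀, h₀, θ, hθ, -, rfl⟩
    exact ⟨θ₀, h₀, θ, hθ, rfl⟩
  · rintro ⟨θ₀, h₀, θ, hθ, rfl⟩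
    exact ⟨θ₀, h₀, θ, hθ, fun j hj => absurd (Fin.castSucc_lt_last j) (not_lt.2 hj), rfl⟩

theorem partialBasis_subset (i : Fin (n + 1)) :
    T.partialBasis Θ₀ i ⊆ T.canonicalBasis Θ₀ := by
  rintro ξ ⟨θ₀, h₀, θ, hθ, -, rfl⟩
  exact ⟨θ₀, h₀, θ, hθ, rfl⟩

theorem partialBasis_zero : T.partialBasis Θ₀ 0 = Subtype.val '' Θ₀ := by
  ext ξ
  constructor
  · rintro ⟨θ₀, h₀, θ, -, h1, rfl⟩
    refine ⟨θ₀, h₀, ?_⟩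
    rw [Finset.prod_eq_one fun j _ => h1 j (Fin.zero_le _), mul_one]
  · rintro ⟨θ₀, h₀, rfl⟩
    exact ⟨θ₀, h₀, 1, T.one_mem_stepBasis, fun _ _ => rfl, by simp⟩

/-- Products keep full length, padded by 1, so a factor is split off or inserted by overwriting the
i-th entry. -/
theorem partialBasis_succ (i : Fin n) : T.partialBasis Θ₀ i.succ =
    {x | ∃ a ∈ T.partialBasis Θ₀ i.castSucc, ∃ b ∈ stepBasis (T.F i.castSucc) (T.t i),
      x = a * b} := by
  have hprod : ∀ (θ : Fin n → E) (b : E), θ i = 1 →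
      (∏ j, θ j) * b = ∏ j, Function.update θ i b j := by
    intro θ b h
    rw [Finset.prod_update_of_mem (Finset.mem_univ i),
      ← Finset.prod_sdiff (Finset.subset_univ {i}), Finset.prod_singleton, h, mul_one, mul_comm]
  have hupd : ∀ (θ : Fin n → E) (b : E), (∀ j, θ j ∈ stepBasis (T.F j.castSucc) (T.t j)) →
      b ∈ stepBasis (T.F i.castSucc) (T.t i) →
      ∀ j, Function.update θ i b j ∈ stepBasis (T.F j.castSucc) (T.t j) := by
    intro θ b hθ hb j
    rcases eq_or_ne j i with rfl | hj
    · rwa [Function.update_self]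
    · rw [Function.update_of_ne hj]
      exact hθ j
  ext ξ
  constructor
  · rintro ⟨θ₀, h₀, θ, hθ, h1, rfl⟩
    refine ⟨θ₀ * ∏ j, Function.update θ i 1 j, ⟨θ₀, h₀, _, hupd θ 1 hθ (T.one_mem_stepBasis i),
      fun j hj => ?_, rfl⟩, θ i, hθ i, ?_⟩
    · rcases eq_or_ne j i with rfl | hji
      · rw [Function.update_self]
      · rw [Function.update_of_ne hji]
        refine h1 j (Fin.succ_le_castSucc_iff.2 ?_)
        exact lt_of_le_of_ne (Fin.castSucc_le_castSucc_iff.1 hj) hji.symm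
    · rw [mul_assoc, hprod _ _ (Function.update_self _ _ _), Function.update_idem,
        Function.update_eq_self]
  · rintro ⟨_, ⟨θ₀, h₀, θ, hθ, h1, rfl⟩, b, hb, rfl⟩
    refine ⟨θ₀, h₀, Function.update θ i b, hupd θ b hθ hb, fun j hj => ?_, ?_⟩
    · have hij := Fin.succ_le_castSucc_iff.1 hj
      rw [Function.update_of_ne hij.ne']
      exact h1 j (Fin.castSucc_le_castSucc_iff.2 hij.le)
    · rw [mul_assoc, hprod _ _ (h1 i le_rfl)]

theorem stepBasis_subset_succ (i : Fin n) : stepBasis (T.F i.castSucc) (T.t i) ⊆ T.F i.succ := by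
  rintro θ (⟨j, rfl⟩ | ⟨q, j, m, hm, -, -, -, rfl⟩)
  · exact (T.mem_succ_iff i _).2 ⟨X ^ j, 1, one_ne_zero, by simp⟩
  · exact (T.mem_succ_iff i _).2 ⟨X ^ j, q ^ m, pow_ne_zero _ hm.ne_zero, by simp⟩

variable {Θ₀}

/-- Multiplicativity of bases in a tower, kept at every level so that each field is spanned by part
of the final basis. -/
theorem partialBasis_spec (hindep : LinearIndepOn (constField σ) id Θ₀)
    (hspan : Submodule.span (constField σ) Θ₀ = ⊤) (i : Fin (n + 1)) :
    T.partialBasis Θ₀ i ⊆ T.F i ∧ LinearIndepOn (constField σ) id (T.partialBasis Θ₀ i) ∧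
      ∀ x ∈ T.F i, x ∈ Submodule.span (constField σ) (T.partialBasis Θ₀ i) := by
  induction i using Fin.induction with
  | zero =>
    rw [partialBasis_zero]
    refine ⟨?_, ?_, fun x hx => ?_⟩
    · rintro _ ⟨x, -, rfl⟩
      exact x.2
    · exact LinearIndepOn.id_image (v := (Subtype.val : T.F 0 → E))
        (LinearIndependent.map' hindep (T.F 0).val.toLinearMap
          (LinearMap.ker_eq_bot.2 Subtype.val_injective))
    · have h := Submodule.mem_map_of_mem (f := (T.F 0).val.toLinearMap)
        (hspan ▸ Submodule.mem_top : (⟨x, hx⟩ : T.F 0) ∈ Submodule.span (constField σ) Θ₀)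
      rw [Submodule.map_span] at h
      exact h
  | succ i ih =>
    obtain ⟨hsub, hind, hsp⟩ := ih
    rw [partialBasis_succ]
    refine ⟨?_, linearIndepOn_mul hsub hind (linearIndepOn_stepBasis (T.transcendental i)),
      fun x hx => mem_span_mul hsp
        (((T.mem_succ_iff i x).1 hx).mem_span_stepBasis (T.transcendental i))⟩
    rintro _ ⟨a, ha, b, hb, rfl⟩
    exact mul_mem (T.le_succ i (hsub ha)) (T.stepBasis_subset_succ i hb)

theorem exists_basis (hindep : LinearIndepOn (constField σ) id Θ₀)
    (hspan : Submodule.span (constField σ) Θ₀ = ⊤) :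
    ∃ B : Module.Basis (T.canonicalBasis Θ₀) (constField σ) E,
      ∀ ξ : T.canonicalBasis Θ₀, B ξ = (ξ : E) := by
  obtain ⟨-, hind, hsp⟩ := T.partialBasis_spec hindep hspan (Fin.last n)
  rw [partialBasis_last] at hind hsp
  refine ⟨Module.Basis.mk (v := fun ξ : T.canonicalBasis Θ₀ => (ξ : E)) hind fun x _ => ?_,
    fun ξ => Module.Basis.mk_apply _ _ _⟩
  rw [Subtype.range_coe]
  exact hsp x (T.top_eq ▸ IntermediateField.mem_top)

/-- The part of the basis at level i already spans that field, so by uniqueness of coordinates the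
expansion of f involves nothing else. -/
theorem mem_of_coord_ne_zero (hindep : LinearIndepOn (constField σ) id Θ₀)
    (hspan : Submodule.span (constField σ) Θ₀ = ⊤)
    {B : Module.Basis (T.canonicalBasis Θ₀) (constField σ) E} (hB : ∀ ξ, B ξ = (ξ : E))
    {i : Fin (n + 1)} {f : E} (hf : f ∈ T.F i) {θ : T.canonicalBasis Θ₀}
    (hθ : B.coord θ f ≠ 0) : (θ : E) ∈ T.F i := by
  obtain ⟨hsub, -, hsp⟩ := T.partialBasis_spec hindep hspan i
  have himage : B '' {ξ | (ξ : E) ∈ T.partialBasis Θ₀ i} = T.partialBasis Θ₀ i := by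
    ext x
    constructor
    · rintro ⟨ξ, hξ, rfl⟩
      rwa [hB]
    · exact fun hx => ⟨⟨x, T.partialBasis_subset Θ₀ i hx⟩, hx, hB _⟩
  have h := hsp f hf
  rw [← himage, B.mem_span_image] at h
  exact hsub (h (Finsupp.mem_support_iff.2 hθ))

theorem exists_mem_ind (f : E) : ∃ i : Fin (n + 1), (i : ℕ) = T.ind f ∧ f ∈ T.F i :=
  Nat.sInf_mem (s := {m : ℕ | ∃ i : Fin (n + 1), (i : ℕ) = m ∧ f ∈ T.F i})
    ⟨_, Fin.last n, rfl, T.top_eq ▸ IntermediateField.mem_top⟩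

theorem ind_le {f : E} {i : Fin (n + 1)} (hf : f ∈ T.F i) : T.ind f ≤ i :=
  Nat.sInf_le ⟨i, rfl, hf⟩

/-- Every nonzero element has an effective basis element with the same indicator. -/
theorem exists_coord_ne_zero_ind_eq (hindep : LinearIndepOn (constField σ) id Θ₀)
    (hspan : Submodule.span (constField σ) Θ₀ = ⊤)
    {B : Module.Basis (T.canonicalBasis Θ₀) (constField σ) E} (hB : ∀ ξ, B ξ = (ξ : E))
    {f : E} (hf : f ≠ 0) : ∃ θ, B.coord θ f ≠ 0 ∧ T.ind (θ : E) = T.ind f := by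
  have hne : (B.repr f).support.Nonempty :=
    Finsupp.support_nonempty_iff.2 ((LinearEquiv.map_ne_zero_iff B.repr).2 hf)
  obtain ⟨θ, hθ, hmax⟩ := Finset.exists_max_image _
    (fun ξ : T.canonicalBasis Θ₀ => T.ind (ξ : E)) hne
  have hθ' : B.coord θ f ≠ 0 := Finsupp.mem_support_iff.1 hθ
  refine ⟨θ, hθ', le_antisymm ?_ ?_⟩
  · obtain ⟨i, hi, hfi⟩ := T.exists_mem_ind f
    rw [← hi]
    exact T.ind_le (T.mem_of_coord_ne_zero hindep hspan hB hfi hθ')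
  -- By maximality all basis elements occurring in f lie in the smallest level containing θ, hence
  -- so does f.
  · obtain ⟨i, hi, -⟩ := T.exists_mem_ind (θ : E)
    rw [← hi]
    refine T.ind_le ?_
    rw [← B.linearCombination_repr f, Finsupp.linearCombination_apply]
    refine (T.F i).toSubalgebra.toSubmodule.sum_mem fun ξ hξ => ?_
    refine Submodule.smul_mem _ _ ?_
    obtain ⟨j, hj, hξj⟩ := T.exists_mem_ind (ξ : E)
    rw [hB]
    refine T.F_monotone (Fin.le_def.2 ?_) hξj
    rw [hj, hi]
    exact hmax ξ hξ

end SigmaTower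

end SigmaReduction

/-! ### Recursion along the tower. -/

theorem mainTheorem2 {E : Type*} [Field E] [CharZero E] (σ : E ≃+* E) {n : ℕ}
    (T : SigmaReduction.SigmaTower σ n)
    (φ₀ : T.F 0 →ₗ[SigmaReduction.constField σ] T.F 0)
    (hφ₀ : SigmaReduction.IsCompleteReduction (T.summable 0) φ₀)
    (Θ₀ : Set (T.F 0))
    (hΘ₀_indep : LinearIndepOn (SigmaReduction.constField σ) id Θ₀)
    (hΘ₀_span : Submodule.span (SigmaReduction.constField σ) Θ₀ = ⊤)
    (S : Fin n → Set E)
    (hS : ∀ i : Fin n,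
      SigmaReduction.IsRepresentativeSet σ (T.F i.castSucc) (T.t i) (S i)) :
    ∃ B : Module.Basis (T.canonicalBasis Θ₀) (SigmaReduction.constField σ) E,
      (∀ ξ : T.canonicalBasis Θ₀, B ξ = (ξ : E)) ∧
      ∃ φ : ∀ i : Fin (n + 1), T.F i →ₗ[SigmaReduction.constField σ] T.F i,
        φ 0 = φ₀ ∧
        (∀ i : Fin (n + 1), SigmaReduction.IsCompleteReduction (T.summable i) (φ i)) ∧
        ∀ i : Fin n, ∃ (θ : T.canonicalBasis Θ₀) (c : SigmaReduction.constField σ),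
          T.IsSecondPair B i (φ i.castSucc) θ c ∧
          T.ind (θ : E) = T.ind (φ i.castSucc (T.deltaGen i) : E) ∧
          T.EstablishesDecomposition i (S i) (φ i.castSucc) (B.coord θ) (φ i.succ) := by
  obtain ⟨B, hB⟩ := T.exists_basis hΘ₀_indep hΘ₀_span
  have hstep : ∀ (i : Fin n) (φ : {φ : T.F i.castSucc →ₗ[SigmaReduction.constField σ]
      T.F i.castSucc // SigmaReduction.IsCompleteReduction (T.summable i.castSucc) φ}),
      ∃ ψ : {ψ : T.F i.succ →ₗ[SigmaReduction.constField σ] T.F i.succ //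
        SigmaReduction.IsCompleteReduction (T.summable i.succ) ψ},
        ∃ (θ : T.canonicalBasis Θ₀) (c : SigmaReduction.constField σ),
          T.IsSecondPair B i φ.1 θ c ∧
          T.ind (θ : E) = T.ind (φ.1 (T.deltaGen i) : E) ∧
          T.EstablishesDecomposition i (S i) φ.1 (B.coord θ) ψ.1 := by
    rintro i ⟨φ, hφ⟩
    have hne : (φ (T.deltaGen i) : E) ≠ 0 := fun h =>
      T.apply_deltaGen_ne_zero i hφ (Subtype.ext h)
    obtain ⟨θ, hθ, hind⟩ := T.exists_coord_ne_zero_ind_eq hΘ₀_indep hΘ₀_span hB hne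
    obtain ⟨ψ, hψ, hdec⟩ := T.exists_next_reduction i (hS i) hφ hθ
    exact ⟨⟨ψ, hψ⟩, θ, _, ⟨T.mem_of_coord_ne_zero hΘ₀_indep hΘ₀_span hB
      (φ (T.deltaGen i)).2 hθ, rfl, hθ⟩, hind, hdec⟩
  choose next hnext using hstep
  -- The recursion runs through the subtype because constructing each level needs the previous map
  -- to be a complete reduction.
  let φ : ∀ i : Fin (n + 1), {φ : T.F i →ₗ[SigmaReduction.constField σ] T.F i //
      SigmaReduction.IsCompleteReduction (T.summable i) φ} :=
    Fin.induction ⟨φ₀, hφ₀⟩ next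
  exact ⟨B, hB, fun i => (φ i).1, rfl, fun i => (φ i).2, fun i => hnext i (φ i.castSucc)⟩
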